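/- Let $n\ge 0$ and let $Q=(q_{ij})\in M_n(\mathbb C)$ be multiplicatively skew-symmetric, i.e. $q_{ij}q_{ji}=q_{ii}=1$ for all $i,j$. Let $U=S_QV=\mathcal O_Q(\mathbb C^n)$ be the quantum affine space, that is, the $\mathbb C$-algebra generated by $v_1,\dots,v_n$ with relations $v_iv_j=q_{ij}v_jv_i$ for all $i,j$, and let $\sigma$ be its canonical scaling automorphism, $\sigma(v_i)=\big(\prod_{j=1}^n q_{ji}\big)v_i$. Let ${}_\sigma U$ be the $U$-bimodule that is $U$ as a vector space, with $a\cdot x\cdot b=\sigma(a)\,x\,b$. Write $U^e=U\otimes_{\mathbb C}U^{op}$, and let $H_*(U,M)=\mathrm{Tor}^{U^e}_*(M,U)$ and $H^*(U,M)=\mathrm{Ext}_{U^e}^*(U,M)$ be the Hochschild homology and cohomology of $U$ with values in a $U$-bimodule $M$. Then there are isomorphisms of complex vector spaces $$H_i(U,{}_\sigma U)\;\cong\;H^{n-i}(U,U)\qquad\text{for all } i\in\mathbb Z,$$ where groups in negative degree are zero. Explicitly, this holds for $0\le i\le n$, and $H_i(U,{}_\sigma U)=0$ and $H^i(U,U)=0$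 for all $i>n$. -/

import Mathlib

open CategoryTheory
open scoped TensorProduct

noncomputable section

namespace HochschildTheory

open scoped ModuleCat
open MulOpposite

universe u

/-! ### Bimodules over a `k`-algebra `A`, i.e. left modules over `A ⊗[k] Aᵐᵒᵖ` -/

/-- The enveloping algebra `A ⊗ Aᵒᵖ`. A left module over it is the same thing as an `A`-bimodule
on which `k` acts centrally: `(a ⊗ op b) • m = a · m · b`. -/
abbrev Env (k A : Type u) [Field k] [Ring A] [Algebra k A] : Type u := A ⊗[k] Aᵐᵒᵖ

section

variable (k A : Type u) [Field k] [Ring A] [Algebra k A]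

/-- `A` as a bimodule over itself: `(a ⊗ op b) • x = a * x * b`. -/
def regular : ModuleCat.{u} (Env k A) :=
  letI : Module (Env k A) A := instModuleTensorProductMop k A
  ModuleCat.of (Env k A) A

variable {k A}

/-- The bimodule obtained from `M` by twisting the left action along `σ`:
`a` acts on the left as `σ a` did, and the right action is unchanged. -/
def twistLeft (σ : A →ₐ[k] A) (M : ModuleCat.{u} (Env k A)) : ModuleCat.{u} (Env k A) :=
  (ModuleCat.restrictScalars
    (Algebra.TensorProduct.map σ (AlgHom.id k Aᵐᵒᵖ)).toRingHom).obj M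

/-- The relations `(b · m · a) ⊗ x = m ⊗ (a · x · b)` defining the tensor product of two bimodules
over `A ⊗ Aᵒᵖ`; here `m · (a ⊗ op b) = b · m · a` is the right `A ⊗ Aᵒᵖ`-module structure of the
bimodule `M`. -/
def balancedRel (M N : ModuleCat.{u} (Env k A)) : Submodule k (M ⊗[k] N) :=
  Submodule.span k {z | ∃ (a b : A) (m : M) (x : N),
    z = ((b ⊗ₜ[k] op a : Env k A) • m) ⊗ₜ[k] x - m ⊗ₜ[k] ((a ⊗ₜ[k] op b : Env k A) • x)}

/-- The tensor product `M ⊗_{A ⊗ Aᵒᵖ} N` of two bimodules, a `k`-vector space. -/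
abbrev BimodTensor (M N : ModuleCat.{u} (Env k A)) : Type u := (M ⊗[k] N) ⧸ balancedRel M N

/-- A morphism of bimodules is `k`-linear. -/
def homLinear {N N' : ModuleCat.{u} (Env k A)} (f : N ⟶ N') : N →ₗ[k] N' :=
  f.hom.restrictScalars k

theorem balancedRel_le (M : ModuleCat.{u} (Env k A)) {N N' : ModuleCat.{u} (Env k A)}
    (f : N ⟶ N') :
    balancedRel M N ≤ (balancedRel M N').comap ((homLinear f).lTensor M) := by
  refine Submodule.span_le.2 ?_
  rintro _ ⟨a, b, m, x, rfl⟩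
  refine Submodule.subset_span ⟨a, b, m, f.hom x, ?_⟩
  rw [map_sub, LinearMap.lTensor_tmul, LinearMap.lTensor_tmul]
  exact congrArg (fun y => _ - m ⊗ₜ[k] y) (map_smul f.hom (a ⊗ₜ[k] op b : Env k A) x)

/-- The functor `M ⊗_{A ⊗ Aᵒᵖ} -`. -/
def bimodTensor (M : ModuleCat.{u} (Env k A)) : ModuleCat.{u} (Env k A) ⥤ ModuleCat.{u} k where
  obj N := ModuleCat.of k (BimodTensor M N)
  map f := ModuleCat.ofHom
    ((balancedRel M _).mapQ (balancedRel M _) ((homLinear f).lTensor M) (balancedRel_le M f))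
  map_id N := by
    exact ModuleCat.hom_ext (Submodule.linearMap_qext _ (TensorProduct.ext' fun m x => rfl))
  map_comp f g := by
    exact ModuleCat.hom_ext (Submodule.linearMap_qext _ (TensorProduct.ext' fun m x => rfl))

instance (M : ModuleCat.{u} (Env k A)) : (bimodTensor M).Additive where
  map_add {N N'} f g := by
    refine ModuleCat.hom_ext (Submodule.linearMap_qext _ (TensorProduct.ext' fun m x => ?_))
    change (balancedRel M N').mkQ (m ⊗ₜ[k] (f.hom x + g.hom x)) =
      (balancedRel M N').mkQ (m ⊗ₜ[k] f.hom x) + (balancedRel M N').mkQ (m ⊗ₜ[k] g.hom x)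
    rw [TensorProduct.tmul_add, map_add]

/-- Hochschild homology `H_i(A, M)`: the homology of `M ⊗_{A ⊗ Aᵒᵖ} P` for a projective resolution
`P` of the bimodule `A`, i.e. `Tor_i(M, A)` over `A ⊗ Aᵒᵖ`. -/
def homology (M : ModuleCat.{u} (Env k A)) (i : ℕ) : ModuleCat.{u} k :=
  ((bimodTensor M).leftDerived i).obj (regular k A)

/-- Hochschild cohomology `H^i(A, M)`: the cohomology of `Hom_{A ⊗ Aᵒᵖ}(P, M)` for a projective
resolution `P` of the bimodule `A`, i.e. `Ext^i(A, M)` over `A ⊗ Aᵒᵖ`. -/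
def cohomology (M : ModuleCat.{u} (Env k A)) (i : ℕ) : ModuleCat.{u} k :=
  ((Ext k (ModuleCat.{u} (Env k A)) i).obj (Opposite.op (regular k A))).obj M

end

end HochschildTheory

namespace QuantumAffine

/-- `Q` is multiplicatively skew-symmetric: `q_{ij} q_{ji} = q_{ii} = 1`. -/
def IsMultSkewSymm {n : ℕ} (Q : Matrix (Fin n) (Fin n) ℂ) : Prop :=
  (∀ i j, Q i j * Q j i = 1) ∧ ∀ i, Q i i = 1

/-- The relations `v_i v_j = q_{ij} v_j v_i`. -/
inductive Rel {n : ℕ} (Q : Matrix (Fin n) (Fin n) ℂ) :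
    FreeAlgebra ℂ (Fin n) → FreeAlgebra ℂ (Fin n) → Prop
  | comm (i j : Fin n) : Rel Q (FreeAlgebra.ι ℂ i * FreeAlgebra.ι ℂ j)
      (Q i j • (FreeAlgebra.ι ℂ j * FreeAlgebra.ι ℂ i))

/-- The quantum affine space `S_Q V = O_Q(ℂ^n)`. -/
abbrev Space {n : ℕ} (Q : Matrix (Fin n) (Fin n) ℂ) : Type := RingQuot (Rel Q)

/-- The generator `v_i`. -/
def gen {n : ℕ} (Q : Matrix (Fin n) (Fin n) ℂ) (i : Fin n) : Space Q :=
  RingQuot.mkAlgHom ℂ (Rel Q) (FreeAlgebra.ι ℂ i)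

theorem gen_mul_gen {n : ℕ} (Q : Matrix (Fin n) (Fin n) ℂ) (i j : Fin n) :
    gen Q i * gen Q j = Q i j • (gen Q j * gen Q i) := by
  simpa [gen] using RingQuot.mkAlgHom_rel ℂ (Rel.comm (Q := Q) i j)

/-- The algebra endomorphism `v_i ↦ c_i v_i`. -/
def scale {n : ℕ} (Q : Matrix (Fin n) (Fin n) ℂ) (c : Fin n → ℂ) : Space Q →ₐ[ℂ] Space Q :=
  RingQuot.liftAlgHom ℂ ⟨FreeAlgebra.lift ℂ fun i => c i • gen Q i, by
    rintro _ _ ⟨i, j⟩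
    simp only [map_mul, map_smul, FreeAlgebra.lift_ι_apply, smul_mul_smul_comm,
      gen_mul_gen Q i j, smul_smul]
    congr 1
    ring⟩

theorem scale_gen {n : ℕ} (Q : Matrix (Fin n) (Fin n) ℂ) (c : Fin n → ℂ) (i : Fin n) :
    scale Q c (gen Q i) = c i • gen Q i := by
  simp [scale, gen]

theorem scale_comp_scale {n : ℕ} (Q : Matrix (Fin n) (Fin n) ℂ) (c d : Fin n → ℂ)
    (h : ∀ i, c i * d i = 1) : (scale Q c).comp (scale Q d) = AlgHom.id ℂ (Space Q) := by
  apply RingQuot.ringQuot_ext'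
  apply FreeAlgebra.hom_ext
  funext i
  change scale Q c (scale Q d (gen Q i)) = gen Q i
  rw [scale_gen, map_smul, scale_gen, smul_smul, mul_comm, h, one_smul]

/-- The canonical scaling automorphism `σ(v_i) = (∏_j q_{ji}) v_i` of `S_Q V`; its inverse is
`v_i ↦ (∏_j q_{ij}) v_i`. -/
def canonicalScaling {n : ℕ} (Q : Matrix (Fin n) (Fin n) ℂ) (hQ : IsMultSkewSymm Q) :
    Space Q ≃ₐ[ℂ] Space Q :=
  AlgEquiv.ofAlgHom (scale Q fun i => ∏ j, Q j i) (scale Q fun i => ∏ j, Q i j)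
    (scale_comp_scale Q _ _ fun i => by
      rw [← Finset.prod_mul_distrib]; exact Finset.prod_eq_one fun j _ => hQ.1 j i)
    (scale_comp_scale Q _ _ fun i => by
      rw [← Finset.prod_mul_distrib]; exact Finset.prod_eq_one fun j _ => hQ.1 i j)

/-- `U = S_Q V` as a bimodule over itself. -/
abbrev bimodule {n : ℕ} (Q : Matrix (Fin n) (Fin n) ℂ) :
    ModuleCat.{0} (HochschildTheory.Env ℂ (Space Q)) :=
  HochschildTheory.regular ℂ (Space Q)

/-- The bimodule `_σ U`: the space `U` with `a · x · b = σ(a) x b`, for `σ` the canonical scaling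
automorphism. -/
abbrev twistedBimodule {n : ℕ} (Q : Matrix (Fin n) (Fin n) ℂ) (hQ : IsMultSkewSymm Q) :
    ModuleCat.{0} (HochschildTheory.Env ℂ (Space Q)) :=
  HochschildTheory.twistLeft (canonicalScaling Q hQ).toAlgHom (bimodule Q)

end QuantumAffine

end

/-! Quantum affine space is a twist of the polynomial ring by a bicharacter: the ordered monomials
`v^a` form a basis and `v^a v^b = chi(a, b) v^(a+b)` (`mon_mul_mon`, `monBasis`).

Hence `U` has a Koszul bimodule resolution shaped like that of `ℂ[x]`. Its `p`-th term is free over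
`U^e` on the `p`-element subsets of the indices, and `e_{T ∪ {i}}` goes to a signed sum of terms `c
v_i e_T - c' e_T v_i`, with `c, c'` inverse values of `chi`. Dividing each word `v^a e_S v^b` by the
scalar that sorts it into an ordered monomial removes every `chi` (`gaugeBasis_mul_koszulCoeff`). A
linear change of variables then gives the Koszul complex of the variables `X_i` over `ℂ[x]`
(`coord_koszulD`). For that complex the de Rham differential is a homotopy whose anticommutator with
the Koszul differential is the Euler operator (`polyD_polyH_add`), invertible in characteristic zero
away from the constants, and the constants match `U` (`exists_polyD_eq`, `constantCoeff_coord`).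

Tensoring the resolution with `M`, or mapping it to `M`, gives functions from subsets to `M` with a
lowering operator `homD` or a raising operator `cohD`. The complement `T ↦ Tᶜ` exchanges the two
directions. With the scalars `hodge`, the terms `x v_i` match for any bicharacter
(`hodge_insert_right`), while the terms `v_i x` are off by `chi(1, e_i) / chi(e_i, 1)`, where `1` is
the all-ones exponent. This ratio is `∏_j q_{ji}` (`chi_ind_univ`), exactly the factor contributed
by `σ`, so `homD` on `_σ U` is conjugate to `cohD` on `U` (`homD_duality`). -/

namespace QuantumAffine

/-! ### Ordered monomials and the Poincaré–Birkhoff–Witt basis -/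

variable {n : ℕ}

/-- The matrix obtained from `Q` by replacing the entries on and above the diagonal by `1`. -/
def lowerPart (Q : Matrix (Fin n) (Fin n) ℂ) (i j : Fin n) : ℂ := if j < i then Q i j else 1

/-- The bicharacter of `ℕⁿ` that measures the failure of ordered monomials to be multiplicative. -/
noncomputable def chi (Q : Matrix (Fin n) (Fin n) ℂ) (a b : Fin n →₀ ℕ) : ℂ :=
  ∏ i, ∏ j, lowerPart Q i j ^ (a i * b j)

theorem IsMultSkewSymm.ne_zero {Q : Matrix (Fin n) (Fin n) ℂ} (hQ : IsMultSkewSymm Q)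
    (i j : Fin n) : Q i j ≠ 0 :=
  left_ne_zero_of_mul_eq_one (hQ.1 i j)

theorem lowerPart_ne_zero {Q : Matrix (Fin n) (Fin n) ℂ} (hQ : IsMultSkewSymm Q)
    (i j : Fin n) : lowerPart Q i j ≠ 0 := by
  unfold lowerPart
  split_ifs
  exacts [hQ.ne_zero i j, one_ne_zero]

theorem chi_ne_zero {Q : Matrix (Fin n) (Fin n) ℂ} (hQ : IsMultSkewSymm Q)
    (a b : Fin n →₀ ℕ) : chi Q a b ≠ 0 :=
  Finset.prod_ne_zero_iff.2 fun _ _ => Finset.prod_ne_zero_iff.2 fun _ _ =>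
    pow_ne_zero _ (lowerPart_ne_zero hQ _ _)

section

variable (Q : Matrix (Fin n) (Fin n) ℂ)

theorem chi_add_left (a a' b : Fin n →₀ ℕ) : chi Q (a + a') b = chi Q a b * chi Q a' b := by
  simp [chi, add_mul, pow_add, Finset.prod_mul_distrib]

theorem chi_add_right (a b b' : Fin n →₀ ℕ) : chi Q a (b + b') = chi Q a b * chi Q a b' := by
  simp [chi, mul_add, pow_add, Finset.prod_mul_distrib]

@[simp] theorem chi_zero_left (b : Fin n →₀ ℕ) : chi Q 0 b = 1 := by simp [chi]

@[simp] theorem chi_zero_right (a : Fin n →₀ ℕ) : chi Q a 0 = 1 := by simp [chi]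

theorem chi_single_left (i : Fin n) (b : Fin n →₀ ℕ) :
    chi Q (Finsupp.single i 1) b = ∏ j, lowerPart Q i j ^ b j := by
  rw [chi, Finset.prod_eq_single i (fun k _ hk => by simp [Finsupp.single_eq_of_ne hk]) (by simp)]
  simp

@[simp] theorem chi_single_single (i j : Fin n) :
    chi Q (Finsupp.single i 1) (Finsupp.single j 1) = lowerPart Q i j := by
  rw [chi_single_left,
    Finset.prod_eq_single j (fun k _ hk => by simp [Finsupp.single_eq_of_ne hk]) (by simp)]
  simp

/-- The product of the powers `v_j ^ a_j` along a list of indices. -/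
def listMon (a : Fin n →₀ ℕ) (l : List (Fin n)) : Space Q :=
  (l.map fun j => gen Q j ^ a j).prod

theorem gen_mul_gen_pow (i j : Fin n) (m : ℕ) :
    gen Q i * gen Q j ^ m = Q i j ^ m • (gen Q j ^ m * gen Q i) := by
  induction m with
  | zero => simp
  | succ m ih =>
    rw [pow_succ, ← mul_assoc, ih, smul_mul_assoc, mul_assoc, gen_mul_gen Q i j, mul_smul_comm,
      smul_smul, mul_assoc, pow_succ]

/-- Sorting `v_i` into its place moves it only past the `v_j` with `j < i`, each at the cost of
`q_{ij}`. This is why `chi` is built from the entries below the diagonal. -/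
theorem gen_mul_listMon (i : Fin n) (a : Fin n →₀ ℕ) (l : List (Fin n))
    (hl : l.Pairwise (· < ·)) (hi : i ∈ l) :
    gen Q i * listMon Q a l =
      (l.map fun j => lowerPart Q i j ^ a j).prod • listMon Q (a + Finsupp.single i 1) l := by
  induction l with
  | nil => simp at hi
  | cons j t ih =>
    rw [List.pairwise_cons] at hl
    have hcons : ∀ b : Fin n →₀ ℕ, listMon Q b (j :: t) = gen Q j ^ b j * listMon Q b t :=
      fun b => by simp [listMon]
    by_cases hij : i = j
    · subst hij
      have h1 : listMon Q (a + Finsupp.single i 1) t = listMon Q a t := by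
        unfold listMon
        congr 1
        refine List.map_congr_left fun k hk => ?_
        rw [Finsupp.add_apply, Finsupp.single_eq_of_ne (hl.1 k hk).ne', add_zero]
      have h2 : ((i :: t).map fun j => lowerPart Q i j ^ a j).prod = 1 := by
        refine List.prod_eq_one fun x hx => ?_
        obtain ⟨k, hk, rfl⟩ := List.mem_map.1 hx
        have : ¬ k < i := by
          rcases List.mem_cons.1 hk with rfl | hk
          · exact lt_irrefl _
          · exact (hl.1 k hk).not_gt
        simp [lowerPart, this]
      rw [h2, one_smul, hcons, hcons, h1, ← mul_assoc, ← pow_succ']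
      simp
    · have hit : i ∈ t := by simpa [hij] using hi
      have hlt : j < i := hl.1 i hit
      rw [hcons, hcons, ← mul_assoc, gen_mul_gen_pow, smul_mul_assoc, mul_assoc, ih hl.2 hit,
        mul_smul_comm, smul_smul, List.map_cons, List.prod_cons]
      simp [lowerPart, hlt, Finsupp.single_eq_of_ne (Ne.symm hij)]

/-- The ordered monomial `v_1 ^ a_1 ⋯ v_n ^ a_n`. -/
def mon (a : Fin n →₀ ℕ) : Space Q := listMon Q a (List.finRange n)

@[simp] theorem mon_zero : mon Q 0 = 1 := by
  simp [mon, listMon]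

theorem gen_mul_mon (i : Fin n) (a : Fin n →₀ ℕ) :
    gen Q i * mon Q a = chi Q (Finsupp.single i 1) a • mon Q (Finsupp.single i 1 + a) := by
  rw [mon, gen_mul_listMon Q i a _ (List.pairwise_lt_finRange n) (List.mem_finRange i),
    chi_single_left, add_comm a, mon]
  congr 1

theorem gen_eq_mon (i : Fin n) : gen Q i = mon Q (Finsupp.single i 1) := by
  simpa using gen_mul_mon Q i 0

end

variable {Q : Matrix (Fin n) (Fin n) ℂ}

theorem mon_mul_mon (hQ : IsMultSkewSymm Q) (a b : Fin n →₀ ℕ) :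
    mon Q a * mon Q b = chi Q a b • mon Q (a + b) := by
  have key : ∀ (k : ℕ) (i : Fin n) (a : Fin n →₀ ℕ),
      mon Q a * mon Q b = chi Q a b • mon Q (a + b) →
      mon Q (Finsupp.single i k + a) * mon Q b =
        chi Q (Finsupp.single i k + a) b • mon Q (Finsupp.single i k + a + b) := by
    intro k i a h
    induction k with
    | zero => simpa using h
    | succ k ih =>
      have h0 := chi_ne_zero hQ (Finsupp.single i 1) (Finsupp.single i k + a)
      rw [add_comm k 1, Finsupp.single_add, add_assoc]
      -- Since `chi` is nonzero, one more factor `v_i` can be split off the left monomial after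
      -- multiplying both sides by its sorting scalar.
      refine smul_right_injective _ h0 ?_
      change _ • (_ * _) = _ • _
      rw [← smul_mul_assoc, ← gen_mul_mon, mul_assoc, ih, mul_smul_comm, gen_mul_mon, smul_smul,
        smul_smul, chi_add_right Q (Finsupp.single i 1), chi_add_left Q (Finsupp.single i 1),
        add_assoc (Finsupp.single i 1)]
      congr 1
      ring
  induction a using Finsupp.induction with
  | zero => simp
  | single_add i k a _ _ ih => exact key k i a ih

/-- Left multiplication by `v_i` in coordinates with respect to the ordered monomials. -/
noncomputable def genOp (Q : Matrix (Fin n) (Fin n) ℂ) (i : Fin n) :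
    Module.End ℂ ((Fin n →₀ ℕ) →₀ ℂ) :=
  Finsupp.lsum ℂ fun a => chi Q (Finsupp.single i 1) a •
    Finsupp.lsingle (Finsupp.single i 1 + a)

theorem genOp_single (i : Fin n) (a : Fin n →₀ ℕ) (c : ℂ) :
    genOp Q i (Finsupp.single a c) =
      Finsupp.single (Finsupp.single i 1 + a) (chi Q (Finsupp.single i 1) a * c) := by
  simp [genOp]

/-- This is the defining relation seen on sorting scalars; it makes the operators `genOp` satisfy
the relations of `U`. -/
theorem lowerPart_eq (hQ : IsMultSkewSymm Q) (i j : Fin n) :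
    lowerPart Q i j = Q i j * lowerPart Q j i := by
  unfold lowerPart
  rcases lt_trichotomy i j with h | rfl | h
  · simp [h, h.not_gt, hQ.1 i j]
  · simp [hQ.2 i]
  · simp [h, h.not_gt]

/-- The action of the quantum affine space on the span of the ordered monomials. -/
noncomputable def monAction (hQ : IsMultSkewSymm Q) :
    Space Q →ₐ[ℂ] Module.End ℂ ((Fin n →₀ ℕ) →₀ ℂ) :=
  RingQuot.liftAlgHom ℂ ⟨FreeAlgebra.lift ℂ (genOp Q), by
    rintro _ _ ⟨i, j⟩
    simp only [map_mul, map_smul, FreeAlgebra.lift_ι_apply]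
    refine Finsupp.lhom_ext fun a c => ?_
    simp only [Module.End.mul_apply, LinearMap.smul_apply, genOp_single, Finsupp.smul_single,
      chi_add_right, chi_single_single, smul_eq_mul, lowerPart_eq hQ i j, add_left_comm]
    congr 1
    ring⟩

theorem monAction_gen (hQ : IsMultSkewSymm Q) (i : Fin n) : monAction hQ (gen Q i) = genOp Q i := by
  simp [monAction, gen]

/-- The coordinates with respect to the ordered monomials. -/
noncomputable def monCoord (hQ : IsMultSkewSymm Q) : Space Q →ₗ[ℂ] ((Fin n →₀ ℕ) →₀ ℂ) :=
  (LinearMap.applyₗ (Finsupp.single 0 1)).comp (monAction hQ).toLinearMap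

theorem monCoord_gen_mul (hQ : IsMultSkewSymm Q) (i : Fin n) (u : Space Q) :
    monCoord hQ (gen Q i * u) = genOp Q i (monCoord hQ u) := by
  simp [monCoord, monAction_gen]

/-- Acting on the exponent `0` recovers the exponent of an ordered monomial, so no linear relation
between the monomials can hold. -/
theorem monCoord_mon (hQ : IsMultSkewSymm Q) (a : Fin n →₀ ℕ) :
    monCoord hQ (mon Q a) = Finsupp.single a 1 := by
  have key : ∀ (k : ℕ) (i : Fin n) (a : Fin n →₀ ℕ), monCoord hQ (mon Q a) = Finsupp.single a 1 →
      monCoord hQ (mon Q (Finsupp.single i k + a)) = Finsupp.single (Finsupp.single i k + a) 1 := by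
    intro k i a h
    induction k with
    | zero => simpa using h
    | succ k ih =>
      have h0 := chi_ne_zero hQ (Finsupp.single i 1) (Finsupp.single i k + a)
      rw [add_comm k 1, Finsupp.single_add, add_assoc]
      refine smul_right_injective _ h0 ?_
      change _ • _ = _ • _
      rw [← map_smul, ← gen_mul_mon, monCoord_gen_mul, ih, genOp_single, Finsupp.smul_single,
        smul_eq_mul]
  induction a using Finsupp.induction with
  | zero => simp [monCoord, Module.End.one_apply]
  | single_add i k a _ _ ih => exact key k i a ih

theorem span_mon (Q : Matrix (Fin n) (Fin n) ℂ) : Submodule.span ℂ (Set.range (mon Q)) = ⊤ := by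
  refine top_le_iff.1 fun u _ => ?_
  obtain ⟨w, rfl⟩ := RingQuot.mkAlgHom_surjective ℂ (Rel Q) u
  -- The span is stable under left multiplication by all of `U` and contains `1`.
  have key : ∀ x ∈ Submodule.span ℂ (Set.range (mon Q)),
      RingQuot.mkAlgHom ℂ (Rel Q) w * x ∈ Submodule.span ℂ (Set.range (mon Q)) := by
    induction w using FreeAlgebra.induction with
    | grade0 c =>
      intro x hx
      rw [AlgHom.commutes, Algebra.algebraMap_eq_smul_one, smul_mul_assoc, one_mul]
      exact Submodule.smul_mem _ _ hx
    | grade1 i =>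
      intro x hx
      induction hx using Submodule.span_induction with
      | mem x hx =>
        obtain ⟨a, rfl⟩ := hx
        change gen Q i * _ ∈ _
        rw [gen_mul_mon]
        exact Submodule.smul_mem _ _ (Submodule.subset_span ⟨_, rfl⟩)
      | zero => simp
      | add x y _ _ hx hy => rw [mul_add]; exact Submodule.add_mem _ hx hy
      | smul c x _ hx => rw [mul_smul_comm]; exact Submodule.smul_mem _ _ hx
    | mul u v hu hv =>
      intro x hx
      rw [map_mul, mul_assoc]
      exact hu trivial _ (hv trivial _ hx)
    | add u v hu hv =>
      intro x hx
      rw [map_add, add_mul]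
      exact Submodule.add_mem _ (hu trivial _ hx) (hv trivial _ hx)
  simpa using key 1 (Submodule.subset_span ⟨0, mon_zero Q⟩)

theorem linearIndependent_mon (hQ : IsMultSkewSymm Q) : LinearIndependent ℂ (mon Q) := by
  refine LinearIndependent.of_comp (monCoord hQ) ?_
  have : ⇑(monCoord hQ) ∘ mon Q = fun a => Finsupp.single a 1 := funext (monCoord_mon hQ)
  rw [this]
  simpa using (Finsupp.basisSingleOne (R := ℂ) (ι := Fin n →₀ ℕ)).linearIndependent

/-- The Poincaré–Birkhoff–Witt basis of ordered monomials. -/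
noncomputable def monBasis (hQ : IsMultSkewSymm Q) : Module.Basis (Fin n →₀ ℕ) ℂ (Space Q) :=
  Module.Basis.mk (linearIndependent_mon hQ) (span_mon Q).ge

@[simp] theorem monBasis_apply (hQ : IsMultSkewSymm Q) (a : Fin n →₀ ℕ) :
    monBasis hQ a = mon Q a :=
  Module.Basis.mk_apply _ _ a

end QuantumAffine

/-! ### The Koszul complex of the variables of a polynomial ring -/

namespace Koszul

variable {n : ℕ}

/-- The subsets of `Fin n` with `p` elements. -/
abbrev Level (n p : ℕ) : Type := {S : Finset (Fin n) // S.card = p}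

/-- The Koszul sign: `(-1)` to the number of elements of `T` that are smaller than `i`. -/
def sgn (T : Finset (Fin n)) (i : Fin n) : ℂ := ∏ j ∈ T, if j < i then -1 else 1

theorem sgn_mul_self (T : Finset (Fin n)) (i : Fin n) : sgn T i * sgn T i = 1 := by
  rw [sgn, ← Finset.prod_mul_distrib]
  exact Finset.prod_eq_one fun j _ => by split_ifs <;> norm_num

theorem sgn_ne_zero (T : Finset (Fin n)) (i : Fin n) : sgn T i ≠ 0 :=
  left_ne_zero_of_mul_eq_one (sgn_mul_self T i)

theorem sgn_insert {T : Finset (Fin n)} {j : Fin n} (hj : j ∉ T) (i : Fin n) :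
    sgn (insert j T) i = (if j < i then -1 else 1) * sgn T i :=
  Finset.prod_insert hj

/-- Exactly one of `i < j` and `j < i` holds, so exactly one side picks up an extra sign. -/
theorem sgn_insert_mul_sgn {T : Finset (Fin n)} {i j : Fin n} (hi : i ∉ T) (hj : j ∉ T)
    (hij : i ≠ j) : sgn T i * sgn (insert i T) j = -(sgn T j * sgn (insert j T) i) := by
  rw [sgn_insert hi, sgn_insert hj]
  rcases lt_or_gt_of_ne hij with h | h <;> simp [h, h.not_gt] <;> ring

variable {M N : Type*} [AddCommGroup M] [Module ℂ M] [AddCommGroup N] [Module ℂ N]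

/-- Contraction with the `i`-th coordinate, on functions on the standard basis of the exterior
algebra. -/
def contract (i : Fin n) : (Finset (Fin n) → M) →ₗ[ℂ] (Finset (Fin n) → M) where
  toFun f T := if i ∈ T then 0 else sgn T i • f (insert i T)
  map_add' f g := by ext T; by_cases h : i ∈ T <;> simp [h]
  map_smul' c f := by ext T; by_cases h : i ∈ T <;> simp [h, smul_comm c]

/-- Exterior multiplication by the `i`-th basis vector. -/
def wedge (i : Fin n) : (Finset (Fin n) → M) →ₗ[ℂ] (Finset (Fin n) → M) where
  toFun f S := if i ∈ S then sgn (S.erase i) i • f (S.erase i) else 0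
  map_add' f g := by ext T; by_cases h : i ∈ T <;> simp [h]
  map_smul' c f := by ext T; by_cases h : i ∈ T <;> simp [h, smul_comm c]

theorem contract_apply (i : Fin n) (f : Finset (Fin n) → M) (T : Finset (Fin n)) :
    contract i f T = if i ∈ T then 0 else sgn T i • f (insert i T) := rfl

theorem wedge_apply (i : Fin n) (f : Finset (Fin n) → M) (S : Finset (Fin n)) :
    wedge i f S = if i ∈ S then sgn (S.erase i) i • f (S.erase i) else 0 := rfl

theorem contract_comp (φ : M →ₗ[ℂ] N) (i : Fin n) (f : Finset (Fin n) → M) :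
    contract i (φ ∘ f) = φ ∘ contract i f := by
  ext T; by_cases h : i ∈ T <;> simp [contract_apply, h]

theorem wedge_comp (φ : M →ₗ[ℂ] N) (i : Fin n) (f : Finset (Fin n) → M) :
    wedge i (φ ∘ f) = φ ∘ wedge i f := by
  ext T; by_cases h : i ∈ T <;> simp [wedge_apply, h]

theorem contract_contract (i j : Fin n) (f : Finset (Fin n) → M) :
    contract i (contract j f) = -contract j (contract i f) := by
  ext T
  by_cases hij : i = j
  · subst hij
    by_cases h : i ∈ T <;> simp [contract_apply, h]
  · by_cases hi : i ∈ T <;> by_cases hj : j ∈ T <;>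
      simp [contract_apply, hi, hj, hij, Ne.symm hij, smul_smul]
    rw [sgn_insert_mul_sgn hi hj hij, neg_smul, Finset.insert_comm]

theorem wedge_contract_self (i : Fin n) (f : Finset (Fin n) → M) (S : Finset (Fin n)) :
    wedge i (contract i f) S = if i ∈ S then f S else 0 := by
  by_cases h : i ∈ S <;> simp [contract_apply, wedge_apply, h, smul_smul, sgn_mul_self]

theorem contract_wedge_self (i : Fin n) (f : Finset (Fin n) → M) (S : Finset (Fin n)) :
    contract i (wedge i f) S = if i ∈ S then 0 else f S := by
  by_cases h : i ∈ S <;> simp [contract_apply, wedge_apply, h, smul_smul, sgn_mul_self]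

/-- The Clifford relation between contraction and exterior multiplication, on which the Euler
homotopy formula rests. -/
theorem contract_wedge (i j : Fin n) (f : Finset (Fin n) → M) :
    contract i (wedge j f) + wedge j (contract i f) = if i = j then f else 0 := by
  ext S
  split_ifs with hij
  · subst hij
    by_cases h : i ∈ S <;> simp [contract_wedge_self, wedge_contract_self, h]
  · by_cases hi : i ∈ S <;> by_cases hj : j ∈ S <;>
      simp [contract_apply, wedge_apply, hi, hj, hij, Ne.symm hij, smul_smul]
    obtain ⟨T, hT, rfl⟩ : ∃ T, j ∉ T ∧ insert j T = S :=
      ⟨S.erase j, Finset.notMem_erase j S, Finset.insert_erase hj⟩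
    have hiT : i ∉ T := fun h => hi (Finset.mem_insert_of_mem h)
    have h1 : (insert i (insert j T)).erase j = insert i T := by
      rw [Finset.insert_comm, Finset.erase_insert]
      simp [hT, Ne.symm hij]
    have h2 : sgn (insert j T) i * sgn (insert i T) j + sgn T j * sgn T i = 0 := by
      rw [sgn_insert hT, sgn_insert hiT]
      rcases lt_or_gt_of_ne hij with h | h <;> simp [h, h.not_gt] <;> ring
    rw [h1, Finset.erase_insert hT, ← add_smul, h2, zero_smul]

open MvPolynomial

variable {A : Type*} [CommRing A] [Algebra ℂ A]

/-- The total differential of the Koszul complex of the variables of a polynomial ring. -/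
noncomputable def polyD : (Finset (Fin n) → MvPolynomial (Fin n) A) →ₗ[ℂ]
    (Finset (Fin n) → MvPolynomial (Fin n) A) :=
  ∑ i, contract i ∘ₗ (LinearMap.mulLeft ℂ (X i)).compLeft (Finset (Fin n))

/-- The homotopy of the Koszul complex of the variables given by the de Rham differential. -/
noncomputable def polyH : (Finset (Fin n) → MvPolynomial (Fin n) A) →ₗ[ℂ]
    (Finset (Fin n) → MvPolynomial (Fin n) A) :=
  ∑ i, wedge i ∘ₗ ((pderiv (R := A) i).toLinearMap.restrictScalars ℂ).compLeft (Finset (Fin n))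

theorem polyD_apply (f : Finset (Fin n) → MvPolynomial (Fin n) A) :
    polyD f = ∑ i, contract i (fun S => X i * f S) := by
  simp only [polyD, LinearMap.sum_apply]
  rfl

theorem polyH_apply (f : Finset (Fin n) → MvPolynomial (Fin n) A) :
    polyH f = ∑ i, wedge i (fun S => pderiv i (f S)) := by
  simp only [polyH, LinearMap.sum_apply]
  rfl

/-- Contractions anticommute and multiplications by variables commute, so the square equals its own
negative. -/
theorem polyD_polyD (f : Finset (Fin n) → MvPolynomial (Fin n) A) : polyD (polyD f) = 0 := by
  have h : polyD (polyD f) =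
      ∑ i, ∑ j, contract i (contract j (fun S => X i * (X j * f S))) := by
    rw [polyD_apply]
    refine Finset.sum_congr rfl fun i _ => ?_
    rw [← map_sum]
    congr 1
    funext S
    rw [polyD_apply, Finset.sum_apply, Finset.mul_sum, Finset.sum_apply]
    refine Finset.sum_congr rfl fun j _ => ?_
    exact (congrFun (contract_comp (LinearMap.mulLeft ℂ (X i)) j (fun S => X j * f S)) S).symm
  have h' : polyD (polyD f) = -polyD (polyD f) := by
    conv_lhs => rw [h, Finset.sum_comm]
    rw [h, ← Finset.sum_neg_distrib]
    refine Finset.sum_congr rfl fun i _ => ?_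
    rw [← Finset.sum_neg_distrib]
    refine Finset.sum_congr rfl fun j _ => ?_
    rw [contract_contract]
    simp only [mul_left_comm (X j)]
  have h2 : (2 : ℂ) • polyD (polyD f) = 0 := by rw [two_smul, ← eq_neg_iff_add_eq_zero]; exact h'
  exact (smul_eq_zero.1 h2).resolve_left two_ne_zero

/-- The Euler operator, which multiplies by the total degree. -/
noncomputable def euler (f : Finset (Fin n) → MvPolynomial (Fin n) A) (S : Finset (Fin n)) :
    MvPolynomial (Fin n) A :=
  ∑ i, X i * pderiv i (f S) + S.card • f S

/-- An algebraic Cartan formula. The Clifford relation yields `∑ X_i ∂_i`; the Leibniz correction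
`∂_i X_i = 1` yields one copy of `f S` for each element of `S`. -/
theorem polyD_polyH_add (f : Finset (Fin n) → MvPolynomial (Fin n) A) :
    polyD (polyH f) + polyH (polyD f) = euler f := by
  have h1 : polyD (polyH f) =
      ∑ i, ∑ j, contract i (wedge j (fun S => X i * pderiv j (f S))) := by
    rw [polyD_apply]
    refine Finset.sum_congr rfl fun i _ => ?_
    rw [← map_sum]
    congr 1
    funext S
    rw [polyH_apply, Finset.sum_apply, Finset.mul_sum, Finset.sum_apply]
    refine Finset.sum_congr rfl fun j _ => ?_
    exact (congrFun (wedge_comp (LinearMap.mulLeft ℂ (X i)) j (fun S => pderiv j (f S))) S).symm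
  have h2 : polyH (polyD f) =
      ∑ i, ∑ j, wedge j (contract i (fun S => pderiv j (X i * f S))) := by
    rw [Finset.sum_comm, polyH_apply]
    refine Finset.sum_congr rfl fun j _ => ?_
    rw [← map_sum]
    congr 1
    funext S
    rw [polyD_apply, Finset.sum_apply, map_sum, Finset.sum_apply]
    refine Finset.sum_congr rfl fun i _ => ?_
    exact (congrFun (contract_comp ((pderiv (R := A) j).toLinearMap.restrictScalars ℂ) i
      (fun S => X i * f S)) S).symm
  have h3 : ∀ i j, wedge j (contract i (fun S => pderiv j (X i * f S))) =
      wedge j (contract i (fun S => X i * pderiv j (f S))) +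
        if i = j then wedge i (contract i f) else 0 := by
    intro i j
    split_ifs with hij
    · subst hij
      rw [← map_add, ← map_add]
      congr 2
      funext S
      simp [add_comm]
    · rw [add_zero]
      congr 2
      funext S
      simp [pderiv_X_of_ne hij]
  have h4 : ∀ i j, contract i (wedge j (fun S => X i * pderiv j (f S))) +
      wedge j (contract i (fun S => X i * pderiv j (f S))) =
        if i = j then (fun S => X i * pderiv i (f S)) else 0 := by
    intro i j
    rw [contract_wedge]
    split_ifs with hij
    · rw [hij]
    · rfl
  simp only [h1, h2, h3, ← Finset.sum_add_distrib, ← add_assoc, h4]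
  funext S
  simp only [Finset.sum_add_distrib, Finset.sum_ite_eq, Finset.mem_univ, if_true, Pi.add_apply,
    Finset.sum_apply, wedge_contract_self, euler]
  simp

theorem coeff_euler (f : Finset (Fin n) → MvPolynomial (Fin n) A) (S : Finset (Fin n))
    (c : Fin n →₀ ℕ) :
    coeff c (euler f S) = ((c.degree + S.card : ℕ) : ℂ) • coeff c (f S) := by
  have h : ∀ i, coeff c (X i * pderiv i (f S)) = (c i : ℂ) • coeff c (f S) := by
    intro i
    induction f S using MvPolynomial.induction_on' with
    | monomial m a =>
      rw [X_mul_pderiv_monomial, coeff_smul, coeff_monomial]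
      split_ifs with h
      · rw [h, Nat.cast_smul_eq_nsmul]
      · simp
    | add p q hp hq => rw [map_add, mul_add, coeff_add, hp, hq, coeff_add, smul_add]
  simp only [euler, coeff_add, coeff_sum, h, coeff_smul]
  rw [← Finset.sum_smul, Nat.cast_add, add_smul, Nat.cast_smul_eq_nsmul ℂ S.card,
    Finsupp.degree_eq_sum, Nat.cast_sum]

theorem weight_ne_zero (S : Finset (Fin n)) (c : Fin n →₀ ℕ) (h : ¬(S = ∅ ∧ c = 0)) :
    ((c.degree + S.card : ℕ) : ℂ) ≠ 0 := by
  rw [Nat.cast_ne_zero]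
  intro h0
  rw [Nat.add_eq_zero_iff, Finsupp.degree_eq_zero_iff, Finset.card_eq_zero] at h0
  exact h ⟨h0.2, h0.1⟩

theorem euler_injective (f : Finset (Fin n) → MvPolynomial (Fin n) A)
    (h0 : constantCoeff (f ∅) = 0) (h : euler f = 0) : f = 0 := by
  ext S c
  by_cases hS : S = ∅ ∧ c = 0
  · obtain ⟨rfl, rfl⟩ := hS
    simpa [constantCoeff_eq] using h0
  · have := coeff_euler f S c
    rw [h] at this
    exact (smul_eq_zero.1 this.symm).resolve_left (weight_ne_zero S c hS)

theorem euler_surjective (f : Finset (Fin n) → MvPolynomial (Fin n) A)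
    (h0 : constantCoeff (f ∅) = 0) : ∃ g, euler g = f := by
  -- On the coefficient of `X^c` at `S` the Euler operator is multiplication by `|c| + |S|`, which
  -- vanishes only for `S = ∅`, `c = 0`; the witness divides by it.
  refine ⟨fun S => ∑ c ∈ (f S).support,
    monomial c (((c.degree + S.card : ℕ) : ℂ)⁻¹ • coeff c (f S)), ?_⟩
  ext S c
  rw [coeff_euler, coeff_sum]
  simp only [coeff_monomial, Finset.sum_ite_eq']
  by_cases hS : S = ∅ ∧ c = 0
  · obtain ⟨rfl, rfl⟩ := hS
    simpa [constantCoeff_eq] using h0.symm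
  · split_ifs with hc
    · rw [smul_inv_smul₀ (weight_ne_zero S c hS)]
    · rw [smul_zero, notMem_support_iff.1 hc]

theorem constantCoeff_polyD_apply (f : Finset (Fin n) → MvPolynomial (Fin n) A)
    (S : Finset (Fin n)) : constantCoeff (polyD f S) = 0 := by
  rw [polyD_apply, Finset.sum_apply, map_sum]
  refine Finset.sum_eq_zero fun i _ => ?_
  rw [contract_apply]
  split_ifs
  · simp
  · rw [constantCoeff_eq, coeff_smul, ← constantCoeff_eq, map_mul]
    simp

theorem exists_polyD_eq (f : Finset (Fin n) → MvPolynomial (Fin n) A)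
    (h0 : constantCoeff (f ∅) = 0) (hf : polyD f = 0) : ∃ g, polyD g = f := by
  obtain ⟨g, rfl⟩ := euler_surjective f h0
  refine ⟨polyH g, ?_⟩
  -- The Euler operator commutes with `polyD`, so it kills `polyD g`. By injectivity `polyD g = 0`,
  -- and the homotopy formula reduces to `polyD (polyH g) = euler g`.
  have h1 : euler (polyD g) = 0 := by
    have h2 := congrArg polyD (polyD_polyH_add g)
    rw [map_add, polyD_polyD, zero_add, hf] at h2
    rw [← polyD_polyH_add, polyD_polyD, map_zero, add_zero, h2]
  rw [← polyD_polyH_add, euler_injective _ (constantCoeff_polyD_apply g ∅) h1, map_zero, add_zero]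

/-! ### Total operators on all subsets and their graded pieces -/

section Total

variable {R M : Type*} [Semiring R] [AddCommMonoid M] [Module R M]

/-- The operator on functions of subsets that lowers the degree by one, with matrix entries
`A T i` from the summand of `T ∪ {i}` to that of `T`. -/
def lowering (A : Finset (Fin n) → Fin n → M →ₗ[R] M) :
    (Finset (Fin n) → M) →ₗ[R] (Finset (Fin n) → M) where
  toFun f T := ∑ i, if i ∈ T then 0 else A T i (f (insert i T))
  map_add' f g := by
    funext T
    rw [Pi.add_apply, ← Finset.sum_add_distrib]
    refine Finset.sum_congr rfl fun i _ => ?_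
    split_ifs
    · rw [add_zero]
    · rw [Pi.add_apply, map_add]
  map_smul' c f := by
    funext T
    rw [RingHom.id_apply, Pi.smul_apply, Finset.smul_sum]
    refine Finset.sum_congr rfl fun i _ => ?_
    split_ifs
    · rw [smul_zero]
    · rw [Pi.smul_apply, map_smul]

/-- The operator on functions of subsets that raises the degree by one, with matrix entries
`A T i` from the summand of `T` to that of `T ∪ {i}`. -/
def raising (A : Finset (Fin n) → Fin n → M →ₗ[R] M) :
    (Finset (Fin n) → M) →ₗ[R] (Finset (Fin n) → M) where
  toFun f S := ∑ i, if i ∈ S then A (S.erase i) i (f (S.erase i)) else 0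
  map_add' f g := by
    funext T
    rw [Pi.add_apply, ← Finset.sum_add_distrib]
    refine Finset.sum_congr rfl fun i _ => ?_
    split_ifs
    · rw [Pi.add_apply, map_add]
    · rw [add_zero]
  map_smul' c f := by
    funext T
    rw [RingHom.id_apply, Pi.smul_apply, Finset.smul_sum]
    refine Finset.sum_congr rfl fun i _ => ?_
    split_ifs
    · rw [Pi.smul_apply, map_smul]
    · rw [smul_zero]

variable (A : Finset (Fin n) → Fin n → M →ₗ[R] M)

theorem lowering_apply (f : Finset (Fin n) → M) (T : Finset (Fin n)) :
    lowering A f T = ∑ i, if i ∈ T then 0 else A T i (f (insert i T)) := rfl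

theorem raising_apply (f : Finset (Fin n) → M) (S : Finset (Fin n)) :
    raising A f S = ∑ i, if i ∈ S then A (S.erase i) i (f (S.erase i)) else 0 := rfl

theorem lowering_apply_congr {f g : Finset (Fin n) → M} {T : Finset (Fin n)}
    (h : ∀ i ∉ T, f (insert i T) = g (insert i T)) : lowering A f T = lowering A g T := by
  rw [lowering_apply, lowering_apply]
  refine Finset.sum_congr rfl fun i _ => ?_
  split_ifs with hi
  · rfl
  · rw [h i hi]

theorem raising_apply_congr {f g : Finset (Fin n) → M} {S : Finset (Fin n)}
    (h : ∀ i ∈ S, f (S.erase i) = g (S.erase i)) : raising A f S = raising A g S := by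
  rw [raising_apply, raising_apply]
  refine Finset.sum_congr rfl fun i _ => ?_
  split_ifs with hi
  · rw [h i hi]
  · rfl

variable (R M) in
/-- Extension by zero of functions on the `p`-element subsets. -/
def extendLevel (n p : ℕ) :
    (Level n p → M) →ₗ[R] (Finset (Fin n) → M) where
  toFun f S := if h : S.card = p then f ⟨S, h⟩ else 0
  map_add' f g := by ext S; by_cases h : S.card = p <;> simp [h]
  map_smul' c f := by ext S; by_cases h : S.card = p <;> simp [h]

variable (R M) in
/-- Restriction of functions to the `p`-element subsets. -/
def restrictLevel (n p : ℕ) : (Finset (Fin n) → M) →ₗ[R] (Level n p → M) :=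
  LinearMap.funLeft R M Subtype.val

variable (R)

theorem extendLevel_apply (p : ℕ) (f : Level n p → M) (S : Finset (Fin n)) :
    extendLevel R M n p f S = if h : S.card = p then f ⟨S, h⟩ else 0 := rfl

theorem extendLevel_of_ne {p : ℕ} (f : Level n p → M) {S : Finset (Fin n)} (h : S.card ≠ p) :
    extendLevel R M n p f S = 0 := dif_neg h

theorem restrictLevel_apply (p : ℕ) (f : Finset (Fin n) → M) (S : Level n p) :
    restrictLevel R M n p f S = f S := rfl

@[simp] theorem restrictLevel_extendLevel (p : ℕ) (f : Level n p → M) :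
    restrictLevel R M n p (extendLevel R M n p f) = f := by
  ext ⟨S, h⟩
  simp [restrictLevel_apply, extendLevel_apply, h]

theorem extendLevel_injective (p : ℕ) : Function.Injective (extendLevel R M n p) :=
  Function.LeftInverse.injective (restrictLevel_extendLevel R p)

theorem extendLevel_restrictLevel (p : ℕ) (f : Finset (Fin n) → M)
    (hf : ∀ S : Finset (Fin n), S.card ≠ p → f S = 0) :
    extendLevel R M n p (restrictLevel R M n p f) = f := by
  ext S
  by_cases h : S.card = p <;> simp [restrictLevel_apply, extendLevel_apply, h, hf]

theorem extendLevel_restrictLevel_apply {p : ℕ} (f : Finset (Fin n) → M) {S : Finset (Fin n)}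
    (h : S.card = p) : extendLevel R M n p (restrictLevel R M n p f) S = f S := by
  simp [restrictLevel_apply, extendLevel_apply, h]

variable {R}

theorem lowering_extendLevel_of_card_ne {p : ℕ} (f : Level n p → M) {T : Finset (Fin n)}
    (h : T.card + 1 ≠ p) : lowering A (extendLevel R M n p f) T = 0 := by
  have h0 : lowering A 0 T = 0 := by rw [map_zero]; rfl
  rw [← h0]
  refine lowering_apply_congr A fun i hi => extendLevel_of_ne _ _ ?_
  rwa [Finset.card_insert_of_notMem hi]

theorem raising_extendLevel_of_card_ne {p : ℕ} (f : Level n p → M) {S : Finset (Fin n)}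
    (h : S.card ≠ p + 1) : raising A (extendLevel R M n p f) S = 0 := by
  have h0 : raising A 0 S = 0 := by rw [map_zero]; rfl
  rw [← h0]
  refine raising_apply_congr A fun i hi => extendLevel_of_ne _ _ fun h' => h ?_
  rw [← h', Finset.card_erase_add_one hi]

/-- The graded pieces of a degree-lowering operator. -/
def loweringLevel (p : ℕ) : (Level n (p + 1) → M) →ₗ[R] (Level n p → M) :=
  restrictLevel R M n p ∘ₗ lowering A ∘ₗ extendLevel R M n (p + 1)

/-- The graded pieces of a degree-raising operator. -/
def raisingLevel (p : ℕ) : (Level n p → M) →ₗ[R] (Level n (p + 1) → M) :=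
  restrictLevel R M n (p + 1) ∘ₗ raising A ∘ₗ extendLevel R M n p

theorem extendLevel_loweringLevel (p : ℕ) (f : Level n (p + 1) → M) :
    extendLevel R M n p (loweringLevel A p f) = lowering A (extendLevel R M n (p + 1) f) :=
  extendLevel_restrictLevel _ _ _ fun _ hS =>
    lowering_extendLevel_of_card_ne A f fun h => hS (Nat.succ_injective h)

theorem extendLevel_raisingLevel (p : ℕ) (f : Level n p → M) :
    extendLevel R M n (p + 1) (raisingLevel A p f) = raising A (extendLevel R M n p f) :=
  extendLevel_restrictLevel _ _ _ fun _ hS => raising_extendLevel_of_card_ne A f hS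

theorem loweringLevel_restrictLevel (p : ℕ) (g : Finset (Fin n) → M) :
    loweringLevel A p (restrictLevel R M n (p + 1) g) = restrictLevel R M n p (lowering A g) := by
  funext ⟨S, hS⟩
  refine lowering_apply_congr A fun i hi => extendLevel_restrictLevel_apply _ _ ?_
  rw [Finset.card_insert_of_notMem hi, hS]

theorem raisingLevel_restrictLevel (p : ℕ) (g : Finset (Fin n) → M) :
    raisingLevel A p (restrictLevel R M n p g) = restrictLevel R M n (p + 1) (raising A g) := by
  funext ⟨S, hS⟩
  refine raising_apply_congr A fun i hi => extendLevel_restrictLevel_apply _ _ ?_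
  rw [Finset.card_erase_of_mem hi, hS, Nat.add_sub_cancel]

theorem loweringLevel_eq_zero_iff (p : ℕ) (f : Level n (p + 1) → M) :
    loweringLevel A p f = 0 ↔ lowering A (extendLevel R M n (p + 1) f) = 0 := by
  rw [← extendLevel_loweringLevel]
  exact ⟨fun h => by rw [h, map_zero], fun h => extendLevel_injective R p (by rw [h, map_zero])⟩

theorem raisingLevel_eq_zero_iff (p : ℕ) (f : Level n p → M) :
    raisingLevel A p f = 0 ↔ raising A (extendLevel R M n p f) = 0 := by
  rw [← extendLevel_raisingLevel]
  exact ⟨fun h => by rw [h, map_zero], fun h => extendLevel_injective R _ (by rw [h, map_zero])⟩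

/-- A total preimage may be inhomogeneous, but its component of size `p + 1` is already a preimage.
Exactness and duality can thus be argued without tracking degrees. -/
theorem exists_loweringLevel_eq_iff (p : ℕ) (f : Level n p → M) :
    (∃ g, loweringLevel A p g = f) ↔ ∃ g, lowering A g = extendLevel R M n p f := by
  constructor
  · rintro ⟨g, rfl⟩
    exact ⟨_, (extendLevel_loweringLevel A p g).symm⟩
  · rintro ⟨g, hg⟩
    exact ⟨_, by rw [loweringLevel_restrictLevel, hg, restrictLevel_extendLevel]⟩

theorem exists_raisingLevel_eq_iff (p : ℕ) (f : Level n (p + 1) → M) :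
    (∃ g, raisingLevel A p g = f) ↔ ∃ g, raising A g = extendLevel R M n (p + 1) f := by
  constructor
  · rintro ⟨g, rfl⟩
    exact ⟨_, (extendLevel_raisingLevel A p g).symm⟩
  · rintro ⟨g, hg⟩
    exact ⟨_, by rw [raisingLevel_restrictLevel, hg, restrictLevel_extendLevel]⟩

end Total

end Koszul

/-! ### The Koszul bimodule complex of quantum affine space and its exactness -/

namespace QuantumAffine

open HochschildTheory MulOpposite Koszul

variable {n : ℕ}

/-- The degree of the standard basis vector of the exterior algebra indexed by `T`. -/
noncomputable def ind (T : Finset (Fin n)) : Fin n →₀ ℕ := ∑ j ∈ T, Finsupp.single j 1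

theorem ind_insert {T : Finset (Fin n)} {i : Fin n} (h : i ∉ T) :
    ind (insert i T) = Finsupp.single i 1 + ind T :=
  Finset.sum_insert h

/-- The coefficient of `e_T` in the Koszul differential of `e_{T ∪ {i}}`. -/
noncomputable def koszulCoeff (Q : Matrix (Fin n) (Fin n) ℂ) (T : Finset (Fin n)) (i : Fin n) :
    Env ℂ (Space Q) :=
  sgn T i • ((chi Q (Finsupp.single i 1) (ind T))⁻¹ • (gen Q i ⊗ₜ 1) -
    (chi Q (ind T) (Finsupp.single i 1))⁻¹ • (1 ⊗ₜ op (gen Q i)))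

/-- The total differential of the Koszul bimodule complex of the quantum affine space. -/
noncomputable def koszulD (Q : Matrix (Fin n) (Fin n) ℂ) :
    (Finset (Fin n) → Env ℂ (Space Q)) →ₗ[Env ℂ (Space Q)]
      (Finset (Fin n) → Env ℂ (Space Q)) :=
  lowering fun T i => LinearMap.toSpanSingleton _ _ (koszulCoeff Q T i)

theorem koszulD_apply (Q : Matrix (Fin n) (Fin n) ℂ) (f : Finset (Fin n) → Env ℂ (Space Q))
    (T : Finset (Fin n)) :
    koszulD Q f T = ∑ i, if i ∈ T then 0 else f (insert i T) * koszulCoeff Q T i := rfl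

variable {Q : Matrix (Fin n) (Fin n) ℂ}

/-- The basis `v^a ⊗ v^b` of the enveloping algebra. -/
noncomputable def envBasis (hQ : IsMultSkewSymm Q) :
    Module.Basis ((Fin n →₀ ℕ) × (Fin n →₀ ℕ)) ℂ (Env ℂ (Space Q)) :=
  (monBasis hQ).tensorProduct ((monBasis hQ).map (opLinearEquiv ℂ))

theorem envBasis_apply (hQ : IsMultSkewSymm Q) (a b : Fin n →₀ ℕ) :
    envBasis hQ (a, b) = mon Q a ⊗ₜ op (mon Q b) := by
  simp [envBasis, Module.Basis.tensorProduct_apply]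

/-- The scalar by which the word `v^a e_S v^b` differs from an ordered monomial. -/
noncomputable def gauge (Q : Matrix (Fin n) (Fin n) ℂ) (S : Finset (Fin n))
    (p : (Fin n →₀ ℕ) × (Fin n →₀ ℕ)) : ℂ :=
  (chi Q p.1 (ind S) * chi Q p.1 p.2 * chi Q (ind S) p.2)⁻¹

theorem gauge_ne_zero (hQ : IsMultSkewSymm Q) (S : Finset (Fin n))
    (p : (Fin n →₀ ℕ) × (Fin n →₀ ℕ)) : gauge Q S p ≠ 0 :=
  inv_ne_zero (mul_ne_zero (mul_ne_zero (chi_ne_zero hQ _ _) (chi_ne_zero hQ _ _))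
    (chi_ne_zero hQ _ _))

/-- The basis of the enveloping algebra in which the Koszul differential on the summand of `e_S`
takes its commutative form. -/
noncomputable def gaugeBasis (hQ : IsMultSkewSymm Q) (S : Finset (Fin n)) :
    Module.Basis ((Fin n →₀ ℕ) × (Fin n →₀ ℕ)) ℂ (Env ℂ (Space Q)) :=
  (envBasis hQ).isUnitSMul fun p => (gauge_ne_zero hQ S p).isUnit

theorem gaugeBasis_apply (hQ : IsMultSkewSymm Q) (S : Finset (Fin n)) (a b : Fin n →₀ ℕ) :
    gaugeBasis hQ S (a, b) = gauge Q S (a, b) • (mon Q a ⊗ₜ op (mon Q b)) := by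
  rw [gaugeBasis, Module.Basis.isUnitSMul_apply, envBasis_apply]

theorem mon_mul_gen (hQ : IsMultSkewSymm Q) (a : Fin n →₀ ℕ) (i : Fin n) :
    mon Q a * gen Q i = chi Q a (Finsupp.single i 1) • mon Q (Finsupp.single i 1 + a) := by
  rw [gen_eq_mon, mon_mul_mon hQ, add_comm a]

/-- Both words `v^a v_i e_T v^b` and `v^a e_T v_i v^b` sort to the same monomial as `v^a e_{T ∪ {i}}
v^b`; by bimultiplicativity of `chi`, the scalars in `koszulCoeff` absorb the difference in sorting
scalars. -/
theorem gaugeBasis_mul_koszulCoeff (hQ : IsMultSkewSymm Q) {T : Finset (Fin n)} {i : Fin n}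
    (hi : i ∉ T) (a b : Fin n →₀ ℕ) :
    gaugeBasis hQ (insert i T) (a, b) * koszulCoeff Q T i =
      sgn T i • (gaugeBasis hQ T (Finsupp.single i 1 + a, b) -
        gaugeBasis hQ T (a, Finsupp.single i 1 + b)) := by
  have h1 := chi_ne_zero hQ (Finsupp.single i 1) (ind T)
  have h2 := chi_ne_zero hQ (ind T) (Finsupp.single i 1)
  have h3 := chi_ne_zero hQ a (ind T)
  have h4 := chi_ne_zero hQ a b
  have h5 := chi_ne_zero hQ (ind T) b
  have h6 := chi_ne_zero hQ a (Finsupp.single i 1)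
  have h7 := chi_ne_zero hQ (Finsupp.single i 1) b
  have e1 : gauge Q (insert i T) (a, b) * ((chi Q (Finsupp.single i 1) (ind T))⁻¹ *
      chi Q a (Finsupp.single i 1)) = gauge Q T (Finsupp.single i 1 + a, b) := by
    simp only [gauge, ind_insert hi, chi_add_left, chi_add_right]
    field_simp
  have e2 : gauge Q (insert i T) (a, b) * ((chi Q (ind T) (Finsupp.single i 1))⁻¹ *
      chi Q (Finsupp.single i 1) b) = gauge Q T (a, Finsupp.single i 1 + b) := by
    simp only [gauge, ind_insert hi, chi_add_left, chi_add_right]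
    field_simp
  rw [koszulCoeff, mul_smul_comm, gaugeBasis_apply, gaugeBasis_apply, gaugeBasis_apply, mul_sub,
    smul_mul_smul_comm, smul_mul_smul_comm, Algebra.TensorProduct.tmul_mul_tmul,
    Algebra.TensorProduct.tmul_mul_tmul, mul_one, mul_one, ← op_mul, mon_mul_gen hQ, gen_mul_mon,
    op_smul, TensorProduct.tmul_smul, ← TensorProduct.smul_tmul', smul_smul, smul_smul, mul_assoc,
    mul_assoc, e1, e2]

open MvPolynomial

/-- The involution `X_i ↦ x_i - X_i` of `ℂ[x][X]`. -/
noncomputable def reflect (n : ℕ) : MvPolynomial (Fin n) (MvPolynomial (Fin n) ℂ) ≃ₐ[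
    MvPolynomial (Fin n) ℂ] MvPolynomial (Fin n) (MvPolynomial (Fin n) ℂ) :=
  AlgEquiv.ofAlgHom (aeval fun i => C (X i) - X i) (aeval fun i => C (X i) - X i)
    (by ext i : 1; simp [algHom_C]) (by ext i : 1; simp [algHom_C])

theorem reflect_X (i : Fin n) : reflect n (X i) = C (X i) - X i := by
  simp [reflect]

/-- The monomial basis of `ℂ[x][X]`. -/
noncomputable def polyBasis (n : ℕ) : Module.Basis ((Fin n →₀ ℕ) × (Fin n →₀ ℕ)) ℂ
    (MvPolynomial (Fin n) (MvPolynomial (Fin n) ℂ)) :=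
  (basisMonomials (Fin n) ℂ).smulTower (basisMonomials (Fin n) (MvPolynomial (Fin n) ℂ))

theorem polyBasis_apply (a b : Fin n →₀ ℕ) :
    polyBasis n (a, b) = monomial b (monomial a (1 : ℂ)) := by
  simp [polyBasis, smul_monomial]

/-- Coordinates on the summand of `e_S` in the Koszul bimodule complex that identify the
differential with that of the Koszul complex of the variables of a polynomial ring. -/
noncomputable def coord (hQ : IsMultSkewSymm Q) (S : Finset (Fin n)) :
    Env ℂ (Space Q) ≃ₗ[ℂ] MvPolynomial (Fin n) (MvPolynomial (Fin n) ℂ) :=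
  (gaugeBasis hQ S).equiv (polyBasis n) (Equiv.refl _) ≪≫ₗ
    ((reflect n).restrictScalars ℂ).toLinearEquiv

theorem coord_gaugeBasis (hQ : IsMultSkewSymm Q) (S : Finset (Fin n)) (a b : Fin n →₀ ℕ) :
    coord hQ S (gaugeBasis hQ S (a, b)) = reflect n (monomial b (monomial a (1 : ℂ))) := by
  simp [coord, polyBasis_apply]

/-- In the gauge bases the coefficient acts, up to sign, as `x_i - X_i`, which `reflect` turns into
`X_i`. -/
theorem coord_mul_koszulCoeff (hQ : IsMultSkewSymm Q) {T : Finset (Fin n)} {i : Fin n}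
    (hi : i ∉ T) (x : Env ℂ (Space Q)) :
    coord hQ T (x * koszulCoeff Q T i) = sgn T i • (X i * coord hQ (insert i T) x) := by
  have h : (coord hQ T).toLinearMap ∘ₗ LinearMap.mulRight ℂ (koszulCoeff Q T i) =
      sgn T i • (LinearMap.mulLeft ℂ (X i) ∘ₗ (coord hQ (insert i T)).toLinearMap) := by
    refine (gaugeBasis hQ (insert i T)).ext fun ⟨a, b⟩ => ?_
    have e1 : monomial b (monomial (Finsupp.single i 1 + a) (1 : ℂ)) =
        C (X i) * monomial b (monomial a (1 : ℂ)) := by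
      rw [C_mul_monomial, X, monomial_mul, one_mul]
    have e2 : monomial (Finsupp.single i 1 + b) (monomial a (1 : ℂ)) =
        X i * monomial b (monomial a (1 : ℂ)) := by
      rw [X, monomial_mul, one_mul]
    have e3 : reflect n (C (X i)) = C (X i) := (reflect n).commutes _
    simp only [LinearMap.comp_apply, LinearMap.mulRight_apply, LinearEquiv.coe_coe,
      LinearMap.smul_apply, LinearMap.mulLeft_apply, gaugeBasis_mul_koszulCoeff hQ hi, map_smul,
      map_sub, coord_gaugeBasis, e1, e2, map_mul, e3, reflect_X]
    congr 1
    ring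
  exact LinearMap.congr_fun h x

theorem coord_koszulD (hQ : IsMultSkewSymm Q) (f : Finset (Fin n) → Env ℂ (Space Q)) :
    (fun S => coord hQ S (koszulD Q f S)) = polyD fun S => coord hQ S (f S) := by
  funext T
  rw [koszulD_apply, polyD_apply, map_sum, Finset.sum_apply]
  refine Finset.sum_congr rfl fun i _ => ?_
  rw [contract_apply]
  split_ifs with hi
  · rw [map_zero]
  · exact coord_mul_koszulCoeff hQ hi _

theorem koszulD_koszulD (hQ : IsMultSkewSymm Q) (f : Finset (Fin n) → Env ℂ (Space Q)) :
    koszulD Q (koszulD Q f) = 0 := by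
  funext S
  apply (coord hQ S).injective
  have h := congrFun (coord_koszulD hQ (koszulD Q f)) S
  rw [coord_koszulD, polyD_polyD] at h
  rw [h, Pi.zero_apply, Pi.zero_apply, map_zero]

/-- The multiplication map `a ⊗ b ↦ a * b`. -/
noncomputable def augmentation (Q : Matrix (Fin n) (Fin n) ℂ) : Env ℂ (Space Q) →ₗ[ℂ] Space Q :=
  (LinearMap.applyₗ 1).comp (AlgHom.mulLeftRight ℂ (Space Q)).toLinearMap

theorem augmentation_tmul (a b : Space Q) : augmentation Q (a ⊗ₜ op b) = a * b := by
  simp [augmentation]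

/-- The linear isomorphism from the quantum affine space to the commutative polynomial ring that
matches the ordered monomials. -/
noncomputable def toPoly (hQ : IsMultSkewSymm Q) : Space Q ≃ₗ[ℂ] MvPolynomial (Fin n) ℂ :=
  (monBasis hQ).equiv (basisMonomials (Fin n) ℂ) (Equiv.refl _)

theorem toPoly_mon (hQ : IsMultSkewSymm Q) (a : Fin n →₀ ℕ) :
    toPoly hQ (mon Q a) = monomial a 1 := by
  rw [← monBasis_apply hQ, toPoly, Module.Basis.equiv_apply]
  simp

/-- Setting `X = 0` after the reflection is setting `X_i = x_i` before it, the commutative form of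
multiplication; the gauge at `∅` cancels the factor `chi a b` of `v^a v^b`. -/
theorem constantCoeff_coord (hQ : IsMultSkewSymm Q) (x : Env ℂ (Space Q)) :
    constantCoeff (coord hQ ∅ x) = toPoly hQ (augmentation Q x) := by
  have h : ((aeval (R := MvPolynomial (Fin n) ℂ) fun _ : Fin n =>
        (0 : MvPolynomial (Fin n) ℂ)).toLinearMap.restrictScalars ℂ) ∘ₗ
      (coord hQ ∅).toLinearMap = (toPoly hQ).toLinearMap ∘ₗ augmentation Q := by
    refine (gaugeBasis hQ ∅).ext fun ⟨a, b⟩ => ?_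
    have e1 : gauge Q ∅ (a, b) * chi Q a b = 1 := by
      simp [gauge, ind, chi_ne_zero hQ a b]
    have e2 : ((aeval (R := MvPolynomial (Fin n) ℂ) fun _ : Fin n =>
        (0 : MvPolynomial (Fin n) ℂ)).comp (reflect n).toAlgHom) =
        aeval fun i => X i := by
      ext i : 1
      simp [reflect]
    have e3 := AlgHom.congr_fun e2 (monomial b (monomial a (1 : ℂ)))
    simp only [LinearMap.comp_apply, LinearEquiv.coe_coe, coord_gaugeBasis]
    refine e3.trans ?_
    rw [gaugeBasis_apply, map_smul, augmentation_tmul, mon_mul_mon hQ, smul_smul, e1, one_smul,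
      toPoly_mon, aeval_monomial, Algebra.algebraMap_self, RingHom.id_apply]
    have e4 : (b.prod fun i k => (X i : MvPolynomial (Fin n) ℂ) ^ k) = monomial b 1 :=
      (monomial_eq (s := b) (a := (1 : ℂ))).symm ▸ (by simp)
    rw [e4, monomial_mul, one_mul]
  have h2 := LinearMap.congr_fun h x
  rw [constantCoeff_eq]
  simpa [aeval_zero', constantCoeff_eq] using h2

theorem augmentation_koszulD (hQ : IsMultSkewSymm Q) (f : Finset (Fin n) → Env ℂ (Space Q)) :
    augmentation Q (koszulD Q f ∅) = 0 := by
  apply (toPoly hQ).injective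
  rw [← constantCoeff_coord, map_zero]
  have h := congrFun (coord_koszulD hQ f) ∅
  exact (congrArg constantCoeff h).trans (constantCoeff_polyD_apply _ _)

theorem exists_koszulD_eq (hQ : IsMultSkewSymm Q) (f : Finset (Fin n) → Env ℂ (Space Q))
    (h0 : augmentation Q (f ∅) = 0) (hf : koszulD Q f = 0) : ∃ g, koszulD Q g = f := by
  obtain ⟨g, hg⟩ := exists_polyD_eq (fun S => coord hQ S (f S))
    (by rw [constantCoeff_coord, h0, map_zero])
    (by rw [← coord_koszulD, hf]; funext S; simp)
  refine ⟨fun S => (coord hQ S).symm (g S), funext fun S => (coord hQ S).injective ?_⟩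
  have h := congrFun (coord_koszulD hQ fun S => (coord hQ S).symm (g S)) S
  refine h.trans ?_
  simp only [LinearEquiv.apply_symm_apply]
  exact congrFun hg S

end QuantumAffine

/-! ### The Koszul bimodule resolution -/

/-- An augmented exact complex of modules gives a quasi-isomorphism to the augmentation module. -/
theorem ModuleCat.quasiIso_toSingle₀ {R : Type} [Ring R] (C : ChainComplex (ModuleCat.{0} R) ℕ)
    (X : ModuleCat.{0} R) (φ : C.X 0 ⟶ X) (h : C.d 1 0 ≫ φ = 0) (hφ : Function.Surjective φ)
    (h0 : ∀ f, φ f = 0 → ∃ g, C.d 1 0 g = f) (hC : ∀ p, C.ExactAt (p + 1)) :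
    QuasiIso ((ChainComplex.toSingle₀Equiv C X).symm ⟨φ, h⟩) where
  quasiIsoAt p := by
    have hπ := ChainComplex.toSingle₀Equiv_symm_apply_f_zero φ h
    cases p with
    | zero =>
      rw [ChainComplex.quasiIsoAt₀_iff, ShortComplex.quasiIso_iff_of_zeros' _
        (C.shape 0 0 (by simp)) rfl rfl]
      constructor
      · rw [ShortComplex.moduleCat_exact_iff]
        intro f hf
        change ((ChainComplex.toSingle₀Equiv C X).symm ⟨φ, h⟩).f 0 f = 0 at hf
        rw [hπ] at hf
        exact h0 f hf
      · change Epi (((ChainComplex.toSingle₀Equiv C X).symm ⟨φ, h⟩).f 0)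
        rw [hπ]
        exact (ModuleCat.epi_iff_surjective _).2 hφ
    | succ p =>
      rw [quasiIsoAt_iff_exactAt' _ _ (ChainComplex.exactAt_succ_single_obj _ _)]
      exact hC p

namespace QuantumAffine

open HochschildTheory MulOpposite Koszul

variable {n : ℕ} (Q : Matrix (Fin n) (Fin n) ℂ)

/-- The graded pieces of the Koszul differential. -/
noncomputable def koszulDiff (p : ℕ) :
    (Level n (p + 1) → Env ℂ (Space Q)) →ₗ[Env ℂ (Space Q)] (Level n p → Env ℂ (Space Q)) :=
  loweringLevel (fun T i => LinearMap.toSpanSingleton _ _ (koszulCoeff Q T i)) p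

variable {Q}

theorem koszulDiff_koszulDiff (hQ : IsMultSkewSymm Q) (p : ℕ)
    (f : Level n (p + 2) → Env ℂ (Space Q)) : koszulDiff Q p (koszulDiff Q (p + 1) f) = 0 := by
  refine (loweringLevel_eq_zero_iff _ p _).2 ?_
  rw [koszulDiff, extendLevel_loweringLevel]
  exact koszulD_koszulD hQ _

theorem exists_koszulDiff_eq (hQ : IsMultSkewSymm Q) (p : ℕ)
    (f : Level n (p + 1) → Env ℂ (Space Q)) (hf : koszulDiff Q p f = 0) :
    ∃ g, koszulDiff Q (p + 1) g = f := by
  refine (exists_loweringLevel_eq_iff _ (p + 1) f).2 (exists_koszulD_eq hQ _ ?_ ?_)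
  -- In positive degree the component at `∅` is zero, so the augmentation condition is automatic.
  · rw [extendLevel_of_ne _ _ (by simp), map_zero]
  · exact (loweringLevel_eq_zero_iff _ p f).1 hf

variable (Q)

/-- The augmentation of the Koszul bimodule complex. -/
noncomputable def koszulAug :
    (Level n 0 → Env ℂ (Space Q)) →ₗ[Env ℂ (Space Q)] bimodule Q :=
  LinearMap.toSpanSingleton (Env ℂ (Space Q)) (bimodule Q)
    (show bimodule Q from (1 : Space Q)) ∘ₗ
    LinearMap.proj ⟨∅, Finset.card_empty⟩

theorem koszulAug_apply (f : Level n 0 → Env ℂ (Space Q)) :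
    koszulAug Q f = augmentation Q (f ⟨∅, Finset.card_empty⟩) := rfl

theorem koszulAug_surjective : Function.Surjective (koszulAug Q) := by
  intro u
  refine ⟨fun _ => u ⊗ₜ 1, ?_⟩
  rw [koszulAug_apply]
  exact (augmentation_tmul (Q := Q) u 1).trans (mul_one (M := Space Q) u)

variable {Q}

theorem koszulAug_koszulDiff (hQ : IsMultSkewSymm Q) (f : Level n 1 → Env ℂ (Space Q)) :
    koszulAug Q (koszulDiff Q 0 f) = 0 :=
  augmentation_koszulD hQ _

theorem exists_koszulDiff_zero_eq (hQ : IsMultSkewSymm Q) (f : Level n 0 → Env ℂ (Space Q))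
    (hf : koszulAug Q f = 0) : ∃ g, koszulDiff Q 0 g = f := by
  refine (exists_loweringLevel_eq_iff _ 0 f).2 (exists_koszulD_eq hQ _ hf ?_)
  exact funext fun T => lowering_extendLevel_of_card_ne _ f (Nat.succ_ne_zero _)

/-- The Koszul bimodule complex of the quantum affine space. -/
noncomputable def koszulComplex (hQ : IsMultSkewSymm Q) :
    ChainComplex (ModuleCat.{0} (Env ℂ (Space Q))) ℕ :=
  ChainComplex.of (fun p => ModuleCat.of (Env ℂ (Space Q)) (Level n p → Env ℂ (Space Q)))
    (fun p => ModuleCat.ofHom (koszulDiff Q p))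
    fun p => ModuleCat.hom_ext (LinearMap.ext fun f => koszulDiff_koszulDiff hQ p f)

theorem koszulComplex_d (hQ : IsMultSkewSymm Q) (p : ℕ) :
    (koszulComplex hQ).d (p + 1) p = ModuleCat.ofHom (koszulDiff Q p) :=
  by
  simp [koszulComplex]

theorem koszulComplex_exactAt (hQ : IsMultSkewSymm Q) (p : ℕ) :
    (koszulComplex hQ).ExactAt (p + 1) := by
  rw [HomologicalComplex.exactAt_iff' _ (p + 1 + 1) (p + 1) p (by simp) (by simp),
    ShortComplex.moduleCat_exact_iff]
  intro f hf
  change (koszulComplex hQ).d (p + 1) p f = 0 at hf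
  change ∃ g, (koszulComplex hQ).d (p + 1 + 1) (p + 1) g = f
  rw [koszulComplex_d] at hf ⊢
  exact exists_koszulDiff_eq hQ p f hf

/-- The augmentation of the Koszul bimodule complex, as a morphism of bimodules. -/
noncomputable def koszulAugHom (Q : Matrix (Fin n) (Fin n) ℂ) :
    ModuleCat.of (Env ℂ (Space Q)) (Level n 0 → Env ℂ (Space Q)) ⟶ bimodule Q :=
  ModuleCat.ofHom (Y := bimodule Q) (koszulAug Q)

/-- The Koszul bimodule resolution of the quantum affine space. -/
noncomputable def koszulResolution (hQ : IsMultSkewSymm Q) :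
    ProjectiveResolution (bimodule Q) where
  complex := koszulComplex hQ
  projective p := by
    change Projective (ModuleCat.of (Env ℂ (Space Q)) (Level n p → Env ℂ (Space Q)))
    exact ModuleCat.projective_of_free (Pi.basisFun (Env ℂ (Space Q)) (Level n p))
  π := (ChainComplex.toSingle₀Equiv _ _).symm ⟨koszulAugHom Q, by
    rw [koszulComplex_d hQ 0]
    exact ModuleCat.hom_ext (LinearMap.ext fun f => koszulAug_koszulDiff hQ f)⟩
  quasiIso := ModuleCat.quasiIso_toSingle₀ _ _ _ _ (koszulAug_surjective Q)
    (fun f hf => by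
      rw [koszulComplex_d hQ 0]
      exact exists_koszulDiff_zero_eq hQ f hf) (koszulComplex_exactAt hQ)

end QuantumAffine

/-! ### Tensor products with, and homomorphisms from, free bimodules -/

namespace HochschildTheory

open scoped ModuleCat
open MulOpposite

universe u

variable {k A : Type u} [Field k] [Ring A] [Algebra k A]

/-- The anti-automorphism `a ⊗ op b ↦ b ⊗ op a` of the enveloping algebra. -/
def envFlip : Env k A →ₗ[k] Env k A :=
  TensorProduct.map (opLinearEquiv k).symm.toLinearMap (opLinearEquiv k).toLinearMap ∘ₗ
    (TensorProduct.comm k A Aᵐᵒᵖ).toLinearMap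

@[simp] theorem envFlip_tmul (a b : A) : envFlip (a ⊗ₜ[k] op b) = b ⊗ₜ[k] op a := rfl

@[simp] theorem envFlip_one : envFlip (1 : Env k A) = 1 := rfl

theorem envFlip_mul (x y : Env k A) : envFlip (x * y) = envFlip y * envFlip x := by
  induction x using TensorProduct.induction_on with
  | zero => simp
  | add x x' hx hx' => rw [add_mul, map_add, hx, hx', map_add, mul_add]
  | tmul a b =>
    induction y using TensorProduct.induction_on with
    | zero => simp
    | add y y' hy hy' => rw [mul_add, map_add, hy, hy', map_add, add_mul]
    | tmul c d =>
      obtain ⟨b, rfl⟩ := op_surjective b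
      obtain ⟨d, rfl⟩ := op_surjective d
      simp only [Algebra.TensorProduct.tmul_mul_tmul, ← op_mul, envFlip_tmul]

/-- The class of `m ⊗ x` in the tensor product of bimodules. -/
def bimodTmul {M N : ModuleCat.{u} (Env k A)} (m : M) (x : N) : BimodTensor M N :=
  (balancedRel M N).mkQ (m ⊗ₜ[k] x)

theorem bimodTmul_add_left {M N : ModuleCat.{u} (Env k A)} (m m' : M) (x : N) :
    bimodTmul (m + m') x = bimodTmul m x + bimodTmul m' x := by
  rw [bimodTmul, TensorProduct.add_tmul, map_add]; rfl

theorem bimodTmul_add_right {M N : ModuleCat.{u} (Env k A)} (m : M) (x x' : N) :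
    bimodTmul m (x + x') = bimodTmul m x + bimodTmul m x' := by
  rw [bimodTmul, TensorProduct.tmul_add, map_add]; rfl

/-- The action through `envFlip` is the right `A ⊗ Aᵒᵖ`-module structure of a bimodule; on pure
tensors the identity is a generator of `balancedRel`. -/
theorem envFlip_smul_bimodTmul {M N : ModuleCat.{u} (Env k A)} (r : Env k A) (m : M) (x : N) :
    bimodTmul (envFlip r • m) x = bimodTmul m (r • x) := by
  induction r using TensorProduct.induction_on with
  | zero =>
    have h1 : (0 : Env k A) • m = 0 := zero_smul (Env k A) m
    have h2 : (0 : Env k A) • x = 0 := zero_smul (Env k A) x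
    rw [map_zero, h1, h2, bimodTmul, bimodTmul, TensorProduct.zero_tmul, TensorProduct.tmul_zero]
  | add r s hr hs =>
    rw [map_add, add_smul, add_smul, bimodTmul_add_left, bimodTmul_add_right, hr, hs]
  | tmul a b =>
    obtain ⟨b, rfl⟩ := op_surjective b
    exact (Submodule.Quotient.eq _).2 (Submodule.subset_span ⟨a, b, m, x, rfl⟩)

theorem bimodTensor_induction {M N : ModuleCat.{u} (Env k A)} {p : BimodTensor M N → Prop}
    (h0 : p 0) (ht : ∀ m x, p (bimodTmul m x)) (ha : ∀ x y, p x → p y → p (x + y))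
    (z : BimodTensor M N) : p z := by
  obtain ⟨z, rfl⟩ := (balancedRel M N).mkQ_surjective z
  induction z using TensorProduct.induction_on with
  | zero => rwa [map_zero]
  | tmul m x => exact ht m x
  | add x y hx hy => rw [map_add]; exact ha _ _ hx hy

/-- Multiplication by an element of the enveloping algebra as a `k`-linear map. -/
def envSmul (M : ModuleCat.{u} (Env k A)) (r : Env k A) : M →ₗ[k] M where
  toFun m := r • m
  map_add' := smul_add r
  map_smul' c m := smul_algebra_smul_comm c r m

@[simp] theorem envSmul_apply (M : ModuleCat.{u} (Env k A)) (r : Env k A) (m : M) :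
    envSmul M r m = r • m := rfl

/-- The free bimodule on `I`. -/
def freeBimod (k A I : Type u) [Field k] [Ring A] [Algebra k A] : ModuleCat.{u} (Env k A) :=
  ModuleCat.of (Env k A) (I → Env k A)

section

variable {I : Type u}

/-- The coordinates on a free bimodule. -/
def freeCoeff (s : I) : freeBimod k A I →ₗ[Env k A] Env k A :=
  (LinearMap.proj s : (I → Env k A) →ₗ[Env k A] Env k A)

/-- The standard basis of a free bimodule. -/
def freeGen [DecidableEq I] (s : I) : freeBimod k A I := (Pi.single s 1 : I → Env k A)

theorem freeCoeff_freeGen [DecidableEq I] (s t : I) :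
    freeCoeff (k := k) (A := A) s (freeGen t) = if s = t then 1 else 0 :=
  Pi.single_apply t 1 s

theorem sum_freeCoeff_smul_freeGen [Fintype I] [DecidableEq I] (f : freeBimod k A I) :
    ∑ s, freeCoeff s f • freeGen s = f := by
  have h : ∀ g : I → Env k A, ∑ s, g s • (Pi.single s 1 : I → Env k A) = g := fun g => by
    simpa only [Pi.basisFun_apply, Pi.basisFun_repr] using (Pi.basisFun (Env k A) I).sum_repr g
  exact h f

end

variable (M : ModuleCat.{u} (Env k A)) (I : Type u)

/-- The map `m ⊗ f ↦ (s ↦ m · f s)` on the tensor product with a free bimodule. -/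
def tensorFree : BimodTensor M (freeBimod k A I) →ₗ[k] (I → M) :=
  (balancedRel M (freeBimod k A I)).liftQ
    (TensorProduct.lift (LinearMap.mk₂ k
      (fun m (f : freeBimod k A I) s => envFlip (freeCoeff s f) • m)
      (fun m m' f => funext fun s => smul_add _ _ _)
      (fun c m f => funext fun s => smul_algebra_smul_comm c _ m)
      (fun m f g => funext fun s => by rw [map_add, map_add, add_smul]; rfl)
      (fun c m f => funext fun s => by
        rw [LinearMap.map_smul_of_tower, map_smul, smul_assoc]; rfl))) (by
    refine Submodule.span_le.2 ?_
    rintro _ ⟨a, b, m, f, rfl⟩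
    rw [SetLike.mem_coe, LinearMap.mem_ker, map_sub, sub_eq_zero]
    funext s
    change envFlip (freeCoeff s f) • (b ⊗ₜ[k] op a) • m =
      envFlip (freeCoeff s ((a ⊗ₜ[k] op b : Env k A) • f)) • m
    rw [map_smul, smul_eq_mul, envFlip_mul, mul_smul, envFlip_tmul])

theorem tensorFree_bimodTmul (m : M) (f : freeBimod k A I) :
    tensorFree M I (bimodTmul m f) = fun s => envFlip (freeCoeff s f) • m := rfl

variable {I} [DecidableEq I]

/-- Homomorphisms from a free bimodule, given by their values on the standard basis. -/
def homFree : (freeBimod k A I ⟶ M) →ₗ[k] (I → M) where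
  toFun φ s := φ (freeGen s)
  map_add' _ _ := rfl
  map_smul' _ _ := rfl

theorem homFree_apply (φ : freeBimod k A I ⟶ M) (s : I) :
    homFree M φ s = φ (freeGen s) := rfl

variable [Fintype I]

-- The inverse is `F ↦ ∑ F s ⊗ e_s`: balancing moves the coefficients of `f = ∑ f_s e_s` onto `m`.
variable (I) in
theorem tensorFree_bijective : Function.Bijective (tensorFree M I) := by
  have hinv : ∀ z, ∑ s, bimodTmul (tensorFree M I z s) (freeGen s) = z := by
    intro z
    induction z using bimodTensor_induction with
    | h0 => simp [bimodTmul]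
    | ht m f =>
      rw [tensorFree_bimodTmul]
      simp only [envFlip_smul_bimodTmul]
      conv_rhs => rw [← sum_freeCoeff_smul_freeGen f]
      exact (map_sum (((balancedRel M (freeBimod k A I)).mkQ).comp
        (TensorProduct.mk k M (freeBimod k A I) m)) _ _).symm
    | ha x y hx hy =>
      rw [map_add]
      simp only [Pi.add_apply, bimodTmul_add_left, Finset.sum_add_distrib, hx, hy]
  refine ⟨Function.LeftInverse.injective 
    (g := fun F : I → M => ∑ s, bimodTmul (F s) (freeGen s : freeBimod k A I)) hinv,
    fun F => ⟨∑ s, bimodTmul (F s) (freeGen s), ?_⟩⟩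
  funext t
  rw [map_sum]
  rw [Finset.sum_apply, Finset.sum_eq_single t]
  · rw [tensorFree_bimodTmul]
    beta_reduce
    rw [freeCoeff_freeGen, if_pos rfl, envFlip_one, one_smul]
  · intro s _ hs
    rw [tensorFree_bimodTmul]
    beta_reduce
    rw [freeCoeff_freeGen, if_neg hs.symm, map_zero]
    exact zero_smul (Env k A) (F s)
  · simp

theorem hom_apply_eq_sum (φ : freeBimod k A I ⟶ M) (f : freeBimod k A I) :
    φ f = ∑ s, freeCoeff s f • homFree M φ s := by
  conv_lhs => rw [← sum_freeCoeff_smul_freeGen f]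
  simp only [map_sum, map_smul, homFree_apply]

variable (I) in
theorem homFree_bijective : Function.Bijective (homFree (I := I) M) := by
  refine ⟨fun φ ψ h => ModuleCat.hom_ext (LinearMap.ext fun f => ?_), fun F => ?_⟩
  · exact (hom_apply_eq_sum M φ f).trans (h ▸ (hom_apply_eq_sum M ψ f).symm)
  · refine ⟨ModuleCat.ofHom (Y := M) ((Pi.basisFun (Env k A) I).constr ℕ F), funext fun t => ?_⟩
    have h := (Pi.basisFun (Env k A) I).constr_basis ℕ F t
    rw [Pi.basisFun_apply] at h
    exact h

end HochschildTheory

/-! ### Hochschild homology and cohomology in terms of functions on subsets -/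

/-- An isomorphism in one degree of two complexes of vector spaces that matches the cycles and
the boundaries induces an isomorphism on homology. -/
theorem HomologicalComplex.nonempty_homology_linearEquiv {k : Type} [Field k] {ι ι' : Type*}
    {c : ComplexShape ι} {c' : ComplexShape ι'} (K : HomologicalComplex (ModuleCat.{0} k) c)
    (L : HomologicalComplex (ModuleCat.{0} k) c') (i : ι) (j : ι') (e : K.X i ≃ₗ[k] L.X j)
    (hker : ∀ x, K.d i (c.next i) x = 0 ↔ L.d j (c'.next j) (e x) = 0)
    (him : ∀ x, (∃ y, K.d (c.prev i) i y = x) ↔ ∃ y, L.d (c'.prev j) j y = e x) :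
    Nonempty (K.homology i ≃ₗ[k] L.homology j) := by
  have hk : (LinearMap.ker (K.sc i).g.hom).map e.toLinearMap = LinearMap.ker (L.sc j).g.hom := by
    ext y
    obtain ⟨x, rfl⟩ := e.surjective y
    exact ⟨fun ⟨x', hx', h⟩ => e.injective h ▸ (hker x').1 hx',
      fun h => ⟨x, (hker x).2 h, rfl⟩⟩
  let e' : LinearMap.ker (K.sc i).g.hom ≃ₗ[k] LinearMap.ker (L.sc j).g.hom :=
    e.ofSubmodules _ _ hk
  have hr : (LinearMap.range (K.sc i).moduleCatToCycles).map e'.toLinearMap =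
      LinearMap.range (L.sc j).moduleCatToCycles := by
    ext ⟨y, hy⟩
    obtain ⟨x, rfl⟩ := e.surjective y
    have hx : x ∈ LinearMap.ker (K.sc i).g.hom := (hker x).2 hy
    constructor
    · rintro ⟨_, ⟨z, rfl⟩, h⟩
      obtain ⟨w, hw⟩ := (him x).1 ⟨z, e.injective (congrArg Subtype.val h)⟩
      exact ⟨w, Subtype.ext hw⟩
    · rintro ⟨w, hw⟩
      obtain ⟨z, hz⟩ := (him x).2 ⟨w, congrArg Subtype.val hw⟩
      exact ⟨⟨x, hx⟩, ⟨z, Subtype.ext hz⟩, rfl⟩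
  exact ⟨(K.sc i).moduleCatHomologyIso.toLinearEquiv ≪≫ₗ
    Submodule.Quotient.equiv _ _ e' hr ≪≫ₗ (L.sc j).moduleCatHomologyIso.toLinearEquiv.symm⟩

namespace QuantumAffine

open scoped ModuleCat
open HochschildTheory MulOpposite Koszul

variable {n : ℕ} (Q : Matrix (Fin n) (Fin n) ℂ) (M : ModuleCat.{0} (Env ℂ (Space Q)))

/-- The total differential of the complex that computes Hochschild homology. -/
noncomputable def homD : (Finset (Fin n) → M) →ₗ[ℂ] (Finset (Fin n) → M) :=
  lowering fun T i => envSmul M (envFlip (koszulCoeff Q T i))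

/-- The total differential of the complex that computes Hochschild cohomology. -/
noncomputable def cohD : (Finset (Fin n) → M) →ₗ[ℂ] (Finset (Fin n) → M) :=
  raising fun T i => envSmul M (koszulCoeff Q T i)

/-- The Koszul differential as a morphism of free bimodules. -/
noncomputable def koszulMap (p : ℕ) :
    freeBimod ℂ (Space Q) (Level n (p + 1)) ⟶ freeBimod ℂ (Space Q) (Level n p) :=
  ModuleCat.ofHom (koszulDiff Q p)

theorem freeCoeff_koszulMap (p : ℕ) (f : freeBimod ℂ (Space Q) (Level n (p + 1)))
    (T : Level n p) : freeCoeff T (koszulMap Q p f) =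
      ∑ i, if i ∈ T.1 then 0 else
        (if h : (insert i T.1).card = p + 1 then freeCoeff ⟨insert i T.1, h⟩ f else 0) *
          koszulCoeff Q T.1 i := rfl

theorem tensorFree_map_koszulMap (p : ℕ)
    (z : BimodTensor M (freeBimod ℂ (Space Q) (Level n (p + 1)))) :
    tensorFree M (Level n p) ((bimodTensor M).map (koszulMap Q p) z) =
      loweringLevel (R := ℂ) (fun T i => envSmul M (envFlip (koszulCoeff Q T i))) p
        (tensorFree M (Level n (p + 1)) z) := by
  have h0 : (bimodTensor M).map (koszulMap Q p) 0 = 0 :=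
    map_zero ((bimodTensor M).map (koszulMap Q p)).hom
  have hadd : ∀ x y : BimodTensor M (freeBimod ℂ (Space Q) (Level n (p + 1))),
      (bimodTensor M).map (koszulMap Q p) (x + y) =
        (bimodTensor M).map (koszulMap Q p) x + (bimodTensor M).map (koszulMap Q p) y :=
    map_add ((bimodTensor M).map (koszulMap Q p)).hom
  induction z using bimodTensor_induction with
  | h0 =>
    rw [map_zero, map_zero]
    exact (congrArg (tensorFree M (Level n p)) h0).trans (map_zero _)
  | ha x y hx hy =>
    rw [map_add, map_add, ← hx, ← hy]
    exact (congrArg (tensorFree M (Level n p)) (hadd x y)).trans (map_add _ _ _)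
  | ht m f =>
    have h : (bimodTensor M).map (koszulMap Q p) (bimodTmul m f) =
      bimodTmul m (koszulMap Q p f) := rfl
    rw [h, tensorFree_bimodTmul, tensorFree_bimodTmul]
    funext T
    beta_reduce
    rw [freeCoeff_koszulMap, map_sum, Finset.sum_smul]
    refine Finset.sum_congr rfl fun i _ => ?_
    split_ifs with hi h1
    · rw [map_zero]
      exact zero_smul (Env ℂ (Space Q)) m
    · rw [envFlip_mul, mul_smul, envSmul_apply, extendLevel_apply, dif_pos h1]
    · exact absurd (by rw [Finset.card_insert_of_notMem hi, T.2]) h1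

/-- Precomposition transposes the matrix of the differential: the value at `e_S` collects the terms
`T = S \ {i}` of the boundary of `e_S`. -/
theorem homFree_koszulMap_comp (p : ℕ) (φ : freeBimod ℂ (Space Q) (Level n p) ⟶ M) :
    homFree M (koszulMap Q p ≫ φ) =
      raisingLevel (R := ℂ) (fun T i => envSmul M (koszulCoeff Q T i)) p (homFree M φ) := by
  funext ⟨S, hS⟩
  have h : homFree M (koszulMap Q p ≫ φ) ⟨S, hS⟩ = φ (koszulMap Q p (freeGen ⟨S, hS⟩)) := rfl
  have h0 : ∀ m : M, (0 : Env ℂ (Space Q)) • m = 0 := fun m =>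
    zero_smul (Env ℂ (Space Q)) m
  rw [h, hom_apply_eq_sum]
  simp only [freeCoeff_koszulMap, Finset.sum_smul]
  rw [Finset.sum_comm]
  refine Finset.sum_congr rfl fun i _ => ?_
  split_ifs with hi
  · have hc : (S.erase i).card = p := by rw [Finset.card_erase_of_mem hi, hS, Nat.add_sub_cancel]
    rw [Finset.sum_eq_single ⟨S.erase i, hc⟩]
    · rw [if_neg (Finset.notMem_erase i S)]
      simp only [Finset.insert_erase hi, hS, dif_pos, freeCoeff_freeGen, if_true, one_mul]
      rw [envSmul_apply, extendLevel_apply, dif_pos hc]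
    · rintro ⟨T, hT⟩ _ hne
      split_ifs with hiT h1
      · exact h0 _
      · rw [freeCoeff_freeGen, if_neg, zero_mul]
        · exact h0 _
        · intro he
          refine hne (Subtype.ext ?_)
          have he' : insert i T = S := congrArg Subtype.val he
          change T = S.erase i
          rw [← he']
          exact (Finset.erase_insert hiT).symm
      · rw [zero_mul]
        exact h0 _
    · simp
  · refine Finset.sum_eq_zero fun T _ => ?_
    split_ifs with hiT h1
    · exact h0 _
    · rw [freeCoeff_freeGen, if_neg, zero_mul]
      · exact h0 _
      · intro he
        exact hi (congrArg Subtype.val he ▸ Finset.mem_insert_self i T.1)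
    · rw [zero_mul]
      exact h0 _

variable {Q} (hQ : IsMultSkewSymm Q)

/-- The complex that computes Hochschild homology. -/
noncomputable def homComplex : ChainComplex (ModuleCat.{0} ℂ) ℕ :=
  ((bimodTensor M).mapHomologicalComplex _).obj (koszulComplex hQ)

/-- The complex that computes Hochschild cohomology. -/
noncomputable def cohComplex : CochainComplex (ModuleCat.{0} ℂ) ℕ :=
  (koszulComplex hQ).linearYonedaObj ℂ M

/-- Chains with values in `M` as functions of subsets. -/
noncomputable def homEquiv (p : ℕ) : (homComplex M hQ).X p ≃ₗ[ℂ] (Level n p → M) :=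
  LinearEquiv.ofBijective (tensorFree M (Level n p)) (tensorFree_bijective M _)

/-- Cochains with values in `M` as functions of subsets. -/
noncomputable def cohEquiv (p : ℕ) : (cohComplex M hQ).X p ≃ₗ[ℂ] (Level n p → M) :=
  LinearEquiv.ofBijective (homFree (I := Level n p) M) (homFree_bijective M _)

theorem homEquiv_d (p : ℕ) (x : (homComplex M hQ).X (p + 1)) :
    homEquiv M hQ p ((homComplex M hQ).d (p + 1) p x) =
      loweringLevel (R := ℂ) (fun T i => envSmul M (envFlip (koszulCoeff Q T i))) p
        (homEquiv M hQ (p + 1) x) := by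
  have h : (homComplex M hQ).d (p + 1) p = (bimodTensor M).map (koszulMap Q p) :=
    congrArg (bimodTensor M).map (koszulComplex_d hQ p)
  rw [h]
  exact tensorFree_map_koszulMap Q M p x

theorem cohEquiv_d (p : ℕ) (φ : (cohComplex M hQ).X p) :
    cohEquiv M hQ (p + 1) ((cohComplex M hQ).d p (p + 1) φ) =
      raisingLevel (R := ℂ) (fun T i => envSmul M (koszulCoeff Q T i)) p
        (cohEquiv M hQ p φ) := by
  have h : (cohComplex M hQ).d p (p + 1) φ = koszulMap Q p ≫ φ :=
    congrArg (fun ψ => ψ ≫ φ) (koszulComplex_d hQ p)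
  rw [h]
  exact homFree_koszulMap_comp Q M p φ

theorem homComplex_cycle_iff (p : ℕ) (x : (homComplex M hQ).X p) :
    (homComplex M hQ).d p ((ComplexShape.down ℕ).next p) x = 0 ↔
      homD Q M (extendLevel ℂ M n p (homEquiv M hQ p x)) = 0 := by
  cases p with
  | zero =>
    -- In degree `0` there is no outgoing differential, and `homD` vanishes on functions supported
    -- at `∅`.
    rw [(homComplex M hQ).shape _ _ (by simp)]
    exact ⟨fun _ => funext fun T => lowering_extendLevel_of_card_ne _ _ (Nat.succ_ne_zero _),
      fun _ => rfl⟩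
  | succ p =>
    rw [ChainComplex.next_nat_succ, ← (homEquiv M hQ p).map_eq_zero_iff, homEquiv_d,
      loweringLevel_eq_zero_iff]
    rfl

theorem homComplex_boundary_iff (p : ℕ) (x : (homComplex M hQ).X p) :
    (∃ y, (homComplex M hQ).d ((ComplexShape.down ℕ).prev p) p y = x) ↔
      ∃ g, homD Q M g = extendLevel ℂ M n p (homEquiv M hQ p x) := by
  rw [ChainComplex.prev]
  refine Iff.trans ?_ (exists_loweringLevel_eq_iff _ p _)
  constructor
  · rintro ⟨y, rfl⟩
    exact ⟨_, (homEquiv_d M hQ p y).symm⟩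
  · rintro ⟨g, hg⟩
    refine ⟨(homEquiv M hQ (p + 1)).symm g, (homEquiv M hQ p).injective ?_⟩
    rw [homEquiv_d, LinearEquiv.apply_symm_apply, hg]

theorem cohComplex_cycle_iff (p : ℕ) (x : (cohComplex M hQ).X p) :
    (cohComplex M hQ).d p ((ComplexShape.up ℕ).next p) x = 0 ↔
      cohD Q M (extendLevel ℂ M n p (cohEquiv M hQ p x)) = 0 := by
  rw [CochainComplex.next, ← (cohEquiv M hQ (p + 1)).map_eq_zero_iff, cohEquiv_d,
    raisingLevel_eq_zero_iff]
  rfl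

theorem cohComplex_boundary_iff (p : ℕ) (x : (cohComplex M hQ).X p) :
    (∃ y, (cohComplex M hQ).d ((ComplexShape.up ℕ).prev p) p y = x) ↔
      ∃ g, cohD Q M g = extendLevel ℂ M n p (cohEquiv M hQ p x) := by
  cases p with
  | zero =>
    rw [(cohComplex M hQ).shape _ _ (by simp)]
    constructor
    · rintro ⟨y, rfl⟩
      refine ⟨0, ?_⟩
      rw [map_zero]
      exact ((congrArg (extendLevel ℂ M n 0) (map_zero (cohEquiv M hQ 0))).trans
        (map_zero (extendLevel ℂ M n 0))).symm
    · rintro ⟨g, hg⟩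
      -- There are no boundaries in degree `0`: a raising operator has an empty sum at `∅`, so an
      -- element of degree `0` in its image is zero.
      refine ⟨0, (cohEquiv M hQ 0).injective (extendLevel_injective ℂ 0 ?_)⟩
      rw [← hg, map_zero, map_zero, map_zero]
      funext S
      by_cases hS : S = ∅
      · subst hS
        refine Eq.symm ((raising_apply (R := ℂ) _ g ∅).trans ?_)
        exact Finset.sum_eq_zero fun i _ => if_neg (Finset.notMem_empty i)
      · rw [hg, extendLevel_of_ne _ _ (by rwa [Ne, Finset.card_eq_zero])]
        rfl
  | succ p =>
    rw [CochainComplex.prev_nat_succ]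
    refine Iff.trans ?_ (exists_raisingLevel_eq_iff _ p _)
    constructor
    · rintro ⟨y, rfl⟩
      exact ⟨_, (cohEquiv_d M hQ p y).symm⟩
    · rintro ⟨g, hg⟩
      refine ⟨(cohEquiv M hQ p).symm g, (cohEquiv M hQ (p + 1)).injective ?_⟩
      rw [cohEquiv_d, LinearEquiv.apply_symm_apply, hg]

/-- Hochschild homology is computed by the Koszul resolution. -/
noncomputable def homologyIso (p : ℕ) :
    HochschildTheory.homology M p (k := ℂ) (A := Space Q) ≅ (homComplex M hQ).homology p :=
  (koszulResolution hQ).isoLeftDerivedObj (bimodTensor M) p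

/-- Hochschild cohomology is computed by the Koszul resolution. -/
noncomputable def cohomologyIso (p : ℕ) :
    HochschildTheory.cohomology M p (k := ℂ) (A := Space Q) ≅ (cohComplex M hQ).homology p :=
  (koszulResolution hQ).isoExt p M

end QuantumAffine

/-! ### The duality between cochains of `U` and chains of the twisted bimodule -/

namespace Koszul

variable {n : ℕ}

/-- Every index below `i` lies in exactly one of `T` and `Tᶜ`. The product of signs is thus
independent of `T`, which allows the sign of `hodge` to be a product over the elements of `T`. -/
theorem sgn_mul_sgn_compl_erase {T : Finset (Fin n)} {i : Fin n} (hi : i ∉ T) :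
    sgn T i * sgn (Tᶜ.erase i) i = sgn Finset.univ i := by
  have h : sgn Tᶜ i = sgn (Tᶜ.erase i) i := by
    conv_lhs => rw [← Finset.insert_erase (Finset.mem_compl.2 hi)]
    rw [sgn_insert (Finset.notMem_erase i _)]
    simp
  rw [← h]
  exact Finset.prod_mul_prod_compl T _

end Koszul

namespace QuantumAffine

open scoped ModuleCat
open HochschildTheory MulOpposite Koszul

variable {n : ℕ} (Q : Matrix (Fin n) (Fin n) ℂ)

theorem ind_erase {S : Finset (Fin n)} {i : Fin n} (h : i ∈ S) :
    Finsupp.single i 1 + ind (S.erase i) = ind S :=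
  Finset.add_sum_erase S (fun j => Finsupp.single j 1) h

theorem chi_ind_right (a : Fin n →₀ ℕ) (T : Finset (Fin n)) :
    chi Q a (ind T) = ∏ j ∈ T, chi Q a (Finsupp.single j 1) := by
  induction T using Finset.induction_on with
  | empty => simp [ind]
  | insert i T hi ih => rw [ind_insert hi, chi_add_right, ih, Finset.prod_insert hi]

theorem chi_ind_left (a : Fin n →₀ ℕ) (T : Finset (Fin n)) :
    chi Q (ind T) a = ∏ j ∈ T, chi Q (Finsupp.single j 1) a := by
  induction T using Finset.induction_on with
  | empty => simp [ind]
  | insert i T hi ih => rw [ind_insert hi, chi_add_left, ih, Finset.prod_insert hi]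

/-- The scalar of the Hodge-type duality `e_T ↦ e_{Tᶜ}`. -/
noncomputable def hodge (T : Finset (Fin n)) : ℂ :=
  (chi Q (ind Tᶜ) (ind T))⁻¹ * ∏ j ∈ T, -sgn Finset.univ j

variable {Q}

/-- The source of the twist: moving `v_i` across the top form `e_1 ⋯ e_n` costs exactly the
eigenvalue of `σ` on `v_i`. -/
theorem chi_ind_univ (hQ : IsMultSkewSymm Q) (i : Fin n) :
    chi Q (ind Finset.univ) (Finsupp.single i 1) =
      (∏ j, Q j i) * chi Q (Finsupp.single i 1) (ind Finset.univ) := by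
  rw [chi_ind_left, chi_ind_right, ← Finset.prod_mul_distrib]
  refine Finset.prod_congr rfl fun j _ => ?_
  rw [chi_single_single, chi_single_single, lowerPart_eq hQ]

theorem hodge_ne_zero (hQ : IsMultSkewSymm Q) (T : Finset (Fin n)) : hodge Q T ≠ 0 :=
  mul_ne_zero (inv_ne_zero (chi_ne_zero hQ _ _))
    (Finset.prod_ne_zero_iff.2 fun _ _ => neg_ne_zero.2 (sgn_ne_zero _ _))

/-- Matches the terms `x v_i`. With `S = Tᶜ \ {i}`, both sides contain the inverse of `chi(S, i)
chi(S, T) chi(i, T)`. The minus sign arises because `envFlip` exchanges the two terms of the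
coefficient. -/
theorem hodge_insert_right (hQ : IsMultSkewSymm Q) {T : Finset (Fin n)} {i : Fin n} (hi : i ∉ T) :
    hodge Q (insert i T) * (sgn T i * (chi Q (Finsupp.single i 1) (ind T))⁻¹) =
      -(hodge Q T * (sgn (Tᶜ.erase i) i *
        (chi Q (ind (Tᶜ.erase i)) (Finsupp.single i 1))⁻¹)) := by
  have h1 := chi_ne_zero hQ (Finsupp.single i 1) (ind T)
  have h2 := chi_ne_zero hQ (ind (Tᶜ.erase i)) (Finsupp.single i 1)
  have h3 := chi_ne_zero hQ (ind (Tᶜ.erase i)) (ind T)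
  have h4 := sgn_mul_self T i
  rw [hodge, hodge, Finset.compl_insert, Finset.prod_insert hi, ind_insert hi,
    ← ind_erase (Finset.mem_compl.2 hi), chi_add_right, chi_add_left,
    ← sgn_mul_sgn_compl_erase hi]
  field_simp
  linear_combination (-sgn (Tᶜ.erase i) i * ∏ j ∈ T, -sgn Finset.univ j) * h4

/-- Matches the terms `v_i x`. It reduces to the previous identity by splitting the all-ones
exponent in `chi_ind_univ` into `i`, `T` and `Tᶜ \ {i}`; the factor `∏ q_{ji}` is indispensable
here. -/
theorem hodge_insert_left (hQ : IsMultSkewSymm Q) {T : Finset (Fin n)} {i : Fin n} (hi : i ∉ T) :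
    hodge Q (insert i T) * (sgn T i * ((chi Q (ind T) (Finsupp.single i 1))⁻¹ * ∏ j, Q j i)) =
      -(hodge Q T * (sgn (Tᶜ.erase i) i *
        (chi Q (Finsupp.single i 1) (ind (Tᶜ.erase i)))⁻¹)) := by
  have h1 := chi_ne_zero hQ (Finsupp.single i 1) (ind T)
  have h2 := chi_ne_zero hQ (ind (Tᶜ.erase i)) (Finsupp.single i 1)
  have h3 := chi_ne_zero hQ (ind T) (Finsupp.single i 1)
  have h4 := chi_ne_zero hQ (Finsupp.single i 1) (ind (Tᶜ.erase i))
  have hu : ind (Finset.univ : Finset (Fin n)) =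
      Finsupp.single i 1 + ind T + ind (Tᶜ.erase i) := by
    rw [add_right_comm, ind_erase (Finset.mem_compl.2 hi), add_comm]
    exact (Finset.sum_add_sum_compl T _).symm
  have hs := chi_ind_univ hQ i
  have hii : chi Q (Finsupp.single i 1) (Finsupp.single i 1) = 1 := by
    rw [chi_single_single]; simp [lowerPart]
  simp only [hu, chi_add_left, chi_add_right, hii, one_mul] at hs
  have h5 := hodge_insert_right hQ hi
  have h6 : (chi Q (ind T) (Finsupp.single i 1))⁻¹ * ∏ j, Q j i =
      (chi Q (Finsupp.single i 1) (ind T))⁻¹ * (chi Q (ind (Tᶜ.erase i)) (Finsupp.single i 1) *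
        (chi Q (Finsupp.single i 1) (ind (Tᶜ.erase i)))⁻¹) := by
    field_simp
    linear_combination -hs
  rw [h6]
  calc _ = (hodge Q (insert i T) * (sgn T i * (chi Q (Finsupp.single i 1) (ind T))⁻¹)) *
        (chi Q (ind (Tᶜ.erase i)) (Finsupp.single i 1) *
          (chi Q (Finsupp.single i 1) (ind (Tᶜ.erase i)))⁻¹) := by ring
    _ = _ := by
      rw [h5]
      field_simp

theorem mulLeftRight_algebraMap_tmul_one (c : ℂ) (x : Space Q) :
    AlgHom.mulLeftRight ℂ (Space Q) (algebraMap ℂ (Space Q) c ⊗ₜ 1) x = c • x := by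
  rw [AlgHom.mulLeftRight_apply, unop_one, mul_one, ← Algebra.smul_def]

theorem map_smul_sub_smul {M : ModuleCat.{0} (Env ℂ (Space Q))} {V : Type*} [AddCommGroup V]
    [Module ℂ V] (L : M →ₗ[ℂ] V) (s a b : ℂ) (y z : Env ℂ (Space Q)) (x : M) :
    L ((s • (a • y - b • z)) • x) = (s * a) • L (y • x) - (s * b) • L (z • x) := by
  have h1 : (s • (a • y - b • z)) • x = s • (a • y • x - b • z • x) := by
    rw [smul_assoc s, sub_smul, smul_assoc a, smul_assoc b]
  rw [h1, map_smul L s, map_sub, map_smul L a, map_smul L b, smul_sub, smul_smul, smul_smul]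

/-- The underlying vector space of the regular bimodule. -/
noncomputable def bimoduleEquiv (Q : Matrix (Fin n) (Fin n) ℂ) : bimodule Q ≃ₗ[ℂ] Space Q where
  toFun x := x
  invFun x := x
  map_add' _ _ := rfl
  map_smul' c x := mulLeftRight_algebraMap_tmul_one c (x : Space Q)

theorem bimoduleEquiv_tmul_smul (a b : Space Q) (x : bimodule Q) :
    bimoduleEquiv Q ((a ⊗ₜ[ℂ] op b : Env ℂ (Space Q)) • x) = a * bimoduleEquiv Q x * b :=
  AlgHom.mulLeftRight_apply ℂ (Space Q) a (op b) x

/-- The underlying vector space of the twisted bimodule. -/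
noncomputable def twistedBimoduleEquiv (hQ : IsMultSkewSymm Q) :
    twistedBimodule Q hQ ≃ₗ[ℂ] Space Q where
  toFun x := x
  invFun x := x
  map_add' _ _ := rfl
  map_smul' c x := by
    refine Eq.trans ?_ (mulLeftRight_algebraMap_tmul_one c (show Space Q from x))
    -- The scalar `c` acts through `c ⊗ 1`, hence through `σ(c)`, and `σ` fixes scalars.
    rw [← (canonicalScaling Q hQ).commutes c]
    rfl

theorem twistedBimoduleEquiv_tmul_smul (hQ : IsMultSkewSymm Q) (a b : Space Q)
    (x : twistedBimodule Q hQ) :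
    twistedBimoduleEquiv hQ ((a ⊗ₜ[ℂ] op b : Env ℂ (Space Q)) • x) =
      canonicalScaling Q hQ a * twistedBimoduleEquiv hQ x * b :=
  AlgHom.mulLeftRight_apply ℂ (Space Q) (canonicalScaling Q hQ a) (op b) x

theorem canonicalScaling_gen (hQ : IsMultSkewSymm Q) (i : Fin n) :
    canonicalScaling Q hQ (gen Q i) = (∏ j, Q j i) • gen Q i :=
  scale_gen Q _ i

theorem bimoduleEquiv_koszulCoeff_smul (S : Finset (Fin n)) (i : Fin n) (x : bimodule Q) :
    bimoduleEquiv Q (koszulCoeff Q S i • x) =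
      (sgn S i * (chi Q (Finsupp.single i 1) (ind S))⁻¹) • (gen Q i * bimoduleEquiv Q x) -
      (sgn S i * (chi Q (ind S) (Finsupp.single i 1))⁻¹) • (bimoduleEquiv Q x * gen Q i) := by
  have h1 := bimoduleEquiv_tmul_smul (gen Q i) 1 x
  have h2 := bimoduleEquiv_tmul_smul 1 (gen Q i) x
  rw [mul_one] at h1
  rw [one_mul] at h2
  rw [← h1, ← h2]
  exact map_smul_sub_smul (bimoduleEquiv Q).toLinearMap _ _ _ _ _ x

theorem twistedBimoduleEquiv_envFlip_koszulCoeff_smul (hQ : IsMultSkewSymm Q)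
    (T : Finset (Fin n)) (i : Fin n) (x : twistedBimodule Q hQ) :
    twistedBimoduleEquiv hQ (envFlip (koszulCoeff Q T i) • x) =
      (sgn T i * (chi Q (Finsupp.single i 1) (ind T))⁻¹) •
        (twistedBimoduleEquiv hQ x * gen Q i) -
      (sgn T i * ((chi Q (ind T) (Finsupp.single i 1))⁻¹ * ∏ j, Q j i)) •
        (gen Q i * twistedBimoduleEquiv hQ x) := by
  have h1 := twistedBimoduleEquiv_tmul_smul hQ (gen Q i) 1 x
  have h2 := twistedBimoduleEquiv_tmul_smul hQ 1 (gen Q i) x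
  rw [mul_one, canonicalScaling_gen, smul_mul_assoc] at h1
  rw [map_one, one_mul] at h2
  have h3 : envFlip (koszulCoeff Q T i) =
      sgn T i • ((chi Q (Finsupp.single i 1) (ind T))⁻¹ • ((1 : Space Q) ⊗ₜ[ℂ] op (gen Q i)) -
        (chi Q (ind T) (Finsupp.single i 1))⁻¹ • (gen Q i ⊗ₜ[ℂ] op (1 : Space Q))) := by
    rw [koszulCoeff, map_smul, map_sub, map_smul, map_smul]
    rfl
  rw [h3, ← mul_assoc, mul_smul _ (∏ j, Q j i), ← h1, ← h2]
  exact map_smul_sub_smul (twistedBimoduleEquiv hQ).toLinearMap _ _ _ _ _ x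

/-- The duality between cochains with values in `U` and chains with values in `_σ U`. -/
noncomputable def duality (hQ : IsMultSkewSymm Q) (f : Finset (Fin n) → bimodule Q)
    (T : Finset (Fin n)) : twistedBimodule Q hQ :=
  (twistedBimoduleEquiv hQ).symm (hodge Q T • bimoduleEquiv Q (f Tᶜ))

/-- Adding `i` to `T` is removing `i` from `Tᶜ`, so the two sums agree term by term once the
coefficients of `x v_i` and `v_i x` are compared. -/
theorem homD_duality (hQ : IsMultSkewSymm Q) (f : Finset (Fin n) → bimodule Q) :
    homD Q (twistedBimodule Q hQ) (duality hQ f) = duality hQ (cohD Q (bimodule Q) f) := by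
  funext T
  apply (twistedBimoduleEquiv hQ).injective
  rw [duality, LinearEquiv.apply_symm_apply, homD, cohD, lowering_apply, raising_apply, map_sum,
    map_sum, Finset.smul_sum]
  refine Finset.sum_congr rfl fun i _ => ?_
  by_cases hi : i ∈ T
  · rw [if_pos hi, if_neg (by simpa using hi), map_zero, map_zero, smul_zero]
  · rw [if_neg hi, if_pos (Finset.mem_compl.2 hi), envSmul_apply, envSmul_apply,
      twistedBimoduleEquiv_envFlip_koszulCoeff_smul, bimoduleEquiv_koszulCoeff_smul, duality,
      LinearEquiv.apply_symm_apply, Finset.compl_insert, smul_mul_assoc, mul_smul_comm,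
      smul_smul, smul_smul, smul_sub, smul_smul, smul_smul, mul_comm _ (hodge Q (insert i T)),
      mul_comm _ (hodge Q (insert i T)), hodge_insert_right hQ hi, hodge_insert_left hQ hi,
      neg_smul, neg_smul, sub_neg_eq_add, neg_add_eq_sub]

theorem duality_bijective (hQ : IsMultSkewSymm Q) : Function.Bijective (duality hQ) := by
  constructor
  · intro f g h
    funext S
    have h1 := congrArg (twistedBimoduleEquiv hQ) (congrFun h Sᶜ)
    simp only [duality, LinearEquiv.apply_symm_apply, compl_compl] at h1
    exact (bimoduleEquiv Q).injective (smul_right_injective _ (hodge_ne_zero hQ _) h1)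
  · intro g
    refine ⟨fun S => (bimoduleEquiv Q).symm
      ((hodge Q Sᶜ)⁻¹ • twistedBimoduleEquiv hQ (g Sᶜ)), funext fun T => ?_⟩
    rw [duality, LinearEquiv.apply_symm_apply, compl_compl, smul_inv_smul₀ (hodge_ne_zero hQ _),
      LinearEquiv.symm_apply_apply]

theorem duality_zero (hQ : IsMultSkewSymm Q) : duality hQ 0 = 0 := by
  funext T
  rw [duality, Pi.zero_apply, map_zero, smul_zero, map_zero, Pi.zero_apply]

theorem card_compl_eq_iff {i j : ℕ} (hij : i + j = n) (T : Finset (Fin n)) :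
    Tᶜ.card = j ↔ T.card = i := by
  have h := Finset.card_add_card_compl T
  rw [Fintype.card_fin] at h
  omega

/-- The graded pieces of the duality between cochains and chains. -/
noncomputable def levelDuality (hQ : IsMultSkewSymm Q) {i j : ℕ} (hij : i + j = n) :
    (Level n i → twistedBimodule Q hQ) ≃ₗ[ℂ] (Level n j → bimodule Q) where
  toFun F S := (bimoduleEquiv Q).symm ((hodge Q S.1ᶜ)⁻¹ • twistedBimoduleEquiv hQ
    (F ⟨S.1ᶜ, (card_compl_eq_iff ((add_comm j i).trans hij) S.1).2 S.2⟩))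
  invFun G T := (twistedBimoduleEquiv hQ).symm (hodge Q T.1 • bimoduleEquiv Q
    (G ⟨T.1ᶜ, (card_compl_eq_iff hij T.1).2 T.2⟩))
  map_add' F G := by
    funext S
    simp only [Pi.add_apply, map_add, smul_add]
  map_smul' c F := by
    funext S
    simp only [Pi.smul_apply, map_smul, RingHom.id_apply, smul_comm c]
  left_inv F := by
    funext T
    simp only [compl_compl, LinearEquiv.apply_symm_apply, LinearEquiv.symm_apply_apply,
      smul_inv_smul₀ (hodge_ne_zero hQ _)]
  right_inv G := by
    funext S
    simp only [compl_compl, LinearEquiv.apply_symm_apply, LinearEquiv.symm_apply_apply,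
      inv_smul_smul₀ (hodge_ne_zero hQ _)]

theorem duality_extendLevel (hQ : IsMultSkewSymm Q) {i j : ℕ} (hij : i + j = n)
    (G : Level n j → bimodule Q) :
    duality hQ (extendLevel ℂ _ n j G) =
      extendLevel ℂ _ n i ((levelDuality hQ hij).symm G) := by
  funext T
  rw [duality, extendLevel_apply, extendLevel_apply]
  by_cases hT : T.card = i
  · rw [dif_pos hT, dif_pos ((card_compl_eq_iff hij T).2 hT)]
    rfl
  · rw [dif_neg hT, dif_neg (fun h => hT ((card_compl_eq_iff hij T).1 h)), map_zero, smul_zero,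
      map_zero]

theorem nonempty_homology_linearEquiv_cohomology (hQ : IsMultSkewSymm Q) {i j : ℕ}
    (hij : i + j = n) :
    Nonempty (HochschildTheory.homology (twistedBimodule Q hQ) i ≃ₗ[ℂ]
      HochschildTheory.cohomology (bimodule Q) j) := by
  let e := homEquiv (twistedBimodule Q hQ) hQ i ≪≫ₗ levelDuality hQ hij ≪≫ₗ
    (cohEquiv (bimodule Q) hQ j).symm
  have he : ∀ x, extendLevel ℂ _ n i (homEquiv (twistedBimodule Q hQ) hQ i x) =
      duality hQ (extendLevel ℂ _ n j (cohEquiv (bimodule Q) hQ j (e x))) := by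
    intro x
    rw [duality_extendLevel hQ hij]
    simp [e]
  obtain ⟨E⟩ := HomologicalComplex.nonempty_homology_linearEquiv
    (homComplex (twistedBimodule Q hQ) hQ) (cohComplex (bimodule Q) hQ) i j e
    (fun x => by
      rw [homComplex_cycle_iff, cohComplex_cycle_iff, he, homD_duality, ← duality_zero hQ,
        (duality_bijective hQ).1.eq_iff])
    (fun x => by
      rw [homComplex_boundary_iff, cohComplex_boundary_iff, he]
      rw [(duality_bijective hQ).2.exists]
      simp only [homD_duality, (duality_bijective hQ).1.eq_iff])
  exact ⟨(homologyIso _ hQ i).toLinearEquiv ≪≫ₗ E ≪≫ₗ (cohomologyIso _ hQ j).toLinearEquiv.symm⟩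

theorem isEmpty_level {i : ℕ} (h : n < i) : IsEmpty (Level n i) :=
  ⟨fun S => by
    have h1 := Finset.card_le_univ S.1
    rw [S.2, Fintype.card_fin] at h1
    omega⟩

end QuantumAffine

theorem HomologicalComplex.subsingleton_homology {k : Type} [Field k] {ι : Type*}
    {c : ComplexShape ι} (K : HomologicalComplex (ModuleCat.{0} k) c) (i : ι)
    [Subsingleton (K.X i)] : Subsingleton (K.homology i) :=
  ModuleCat.subsingleton_of_isZero
    (ShortComplex.isZero_homology_of_isZero_X₂ _ (ModuleCat.isZero_of_subsingleton (K.X i)))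

theorem mainTheorem4 (n : ℕ) (Q : Matrix (Fin n) (Fin n) ℂ)
    (hQ : QuantumAffine.IsMultSkewSymm Q) :
    (∀ i j : ℕ, i + j = n →
      Nonempty
        (HochschildTheory.homology (QuantumAffine.twistedBimodule Q hQ) i ≃ₗ[ℂ]
          HochschildTheory.cohomology (QuantumAffine.bimodule Q) j)) ∧
    (∀ i : ℕ, n < i →
      Subsingleton (HochschildTheory.homology (QuantumAffine.twistedBimodule Q hQ) i) ∧
      Subsingleton (HochschildTheory.cohomology (QuantumAffine.bimodule Q) i)) := by
  refine ⟨fun i j hij => QuantumAffine.nonempty_homology_linearEquiv_cohomology hQ hij,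
    fun i hi => ?_⟩
  -- A set of `n` indices has no subset with more than `n` elements, so the chains and cochains
  -- themselves vanish.
  have := QuantumAffine.isEmpty_level hi
  have h1 := (QuantumAffine.homEquiv (QuantumAffine.twistedBimodule Q hQ) hQ i).subsingleton
  have h2 := (QuantumAffine.cohEquiv (QuantumAffine.bimodule Q) hQ i).subsingleton
  have h3 := HomologicalComplex.subsingleton_homology
    (QuantumAffine.homComplex (QuantumAffine.twistedBimodule Q hQ) hQ) i
  have h4 := HomologicalComplex.subsingleton_homology
    (QuantumAffine.cohComplex (QuantumAffine.bimodule Q) hQ) i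
  exact ⟨(QuantumAffine.homologyIso _ hQ i).toLinearEquiv.toEquiv.subsingleton,
    (QuantumAffine.cohomologyIso _ hQ i).toLinearEquiv.toEquiv.subsingleton⟩
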